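/- Let $1<p<\infty$, let $\mathbb T$ be the unit circle, and for a function $a$ on $\mathbb T$ put $\widetilde a(t)=a(1/t)$. Let $H^p$ be the closed subspace of $L^p=L^p(\mathbb T)$ of all functions whose Fourier coefficients $f_n$ vanish for $n<0$, let $P:\sum_{n\in\mathbb Z} f_nt^n\mapsto\sum_{n\ge 0}f_nt^n$ be the (bounded) Riesz projection of $L^p$ onto $H^p$, let $Q=I-P$, and let $(Jf)(t)=\bar t f(\bar t)$. For $a\in L^\infty=L^\infty(\mathbb T)$ let $T(a),H(a):H^p\to H^p$ be the Toeplitz operator $T(a)f=Paf$ and the Hankel operator $H(a)f=PaQJf$. The index of a Fredholm operator $A$ is $\operatorname{ind}A=\dim\ker A-\dim\ker A^*$, where $A^*$ is the Banach space adjoint. Let $a,b\in L^\infty$, with $a$ invertible in $L^\infty$, be a matching pair, that is, $a\widetilde a=b\widetilde b$ almost everywhere on $\mathbb T$ (so $b$ is invertible in $L^\infty$ too), and let $c=ab^{-1}$ and $d=b\,\widetilde a^{-1}$ be its matching functions. Suppose that $T(c)$ and $T(d)$ are Fredholm. (i) If $\operatorname{ind}T(c)\ge 0$ and $\operatorname{ind}T(d)\ge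 0$, then both $T(a)+H(b)$ and $T(a)-H(b)$ are right invertible, i.e. have bounded right inverses on $H^p$. (ii) If $\operatorname{ind}T(c)\le 0$ and $\operatorname{ind}T(d)\le 0$, then both $T(a)+H(b)$ and $T(a)-H(b)$ are left invertible, i.e. have bounded left inverses on $H^p$. -/

import Mathlib

open MeasureTheory Set
open scoped ENNReal Real

noncomputable section

namespace ToeplitzHankel

instance factTwoPiPos : Fact (0 < 2 * π) := ⟨Real.two_pi_pos⟩

/-- The unit circle `𝕋`; the class of `θ` in `ℝ / 2πℤ` stands for the point `t = e^{iθ}`, so that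
the point `conj t = 1/t` corresponds to `-θ` and the function `tⁿ` is `fourier n`. -/
abbrev Torus : Type := AddCircle (2 * π)

/-- Normalised Lebesgue (arc length) measure on the circle. -/
abbrev arc : Measure Torus := AddCircle.haarAddCircle

/-- The Lebesgue spaces `L^p` of the circle. -/
abbrev LpT (p : ℝ≥0∞) : Type := Lp ℂ p arc

/-- The space `L^∞` of the circle. -/
abbrev LInf : Type := LpT ∞

lemma measurePreserving_conj : MeasurePreserving (fun t : Torus => -t) arc arc :=
  Measure.measurePreserving_neg arc

/-- `ã(t) = a(1/t)`. -/
def tilde (a : LInf) : LInf :=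
  Lp.compMeasurePreserving (fun t : Torus => -t) measurePreserving_conj a

/-- Invertibility in the algebra `L^∞`. -/
def IsInvertible (a : LInf) : Prop :=
  ∃ a' : LInf, ∀ᵐ t ∂arc, a t * a' t = 1

open Classical in
/-- The inverse `a⁻¹` in the algebra `L^∞` (and `0` if `a` is not invertible there). -/
def linv (a : LInf) : LInf :=
  if h : IsInvertible a then h.choose else 0

/-- The product in `L^∞`. -/
def lmul (a b : LInf) : LInf := a • b

/-- A matching pair: `a` is invertible in `L^∞` and `a ã = b b̃` almost everywhere. -/
structure IsMatchingPair (a b : LInf) : Prop where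
  invertible : IsInvertible a
  matching : lmul a (tilde a) = lmul b (tilde b)

/-- The first matching function `c = a b⁻¹`. -/
def matchC (a b : LInf) : LInf := lmul a (linv b)

/-- The second matching function `d = b ã⁻¹`. -/
def matchD (a b : LInf) : LInf := lmul b (linv (tilde a))

section Operators

lemma fourierCoeff_lp_smul (p : ℝ≥0∞) (z : ℂ) (f : LpT p) (n : ℤ) :
    fourierCoeff (z • f : LpT p) n = z * fourierCoeff f n := by
  have h : fourierCoeff (z • f : LpT p) n = fourierCoeff (z • (f : Torus → ℂ)) n :=
    integral_congr_ae (by filter_upwards [Lp.coeFn_smul z f] with t ht; rw [ht])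
  rw [h]
  exact fourierCoeff.const_smul _ z n

variable (p : ℝ≥0∞) [Fact (1 ≤ p)]

lemma integrable_coe (f : LpT p) : Integrable (f : Torus → ℂ) arc :=
  (Lp.memLp f).integrable Fact.out

lemma fourierCoeff_lp_add (f g : LpT p) (n : ℤ) :
    fourierCoeff (f + g : LpT p) n = fourierCoeff f n + fourierCoeff g n := by
  have h : fourierCoeff (f + g : LpT p) n = fourierCoeff ((f : Torus → ℂ) + (g : Torus → ℂ)) n :=
    integral_congr_ae (by filter_upwards [Lp.coeFn_add f g] with t ht; rw [ht])
  rw [h, fourierCoeff.add (integrable_coe p f) (integrable_coe p g)]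
  rfl

/-- The Hardy space `H^p`: the functions in `L^p` whose Fourier coefficients of negative index
vanish. -/
def Hardy : Submodule ℂ (LpT p) where
  carrier := {f | ∀ n : ℤ, n < 0 → fourierCoeff f n = 0}
  add_mem' {f g} hf hg n hn := by rw [fourierCoeff_lp_add, hf n hn, hg n hn, add_zero]
  zero_mem' n _ := by
    have h := fourierCoeff_lp_smul p 0 0 n
    rwa [zero_smul, zero_mul] at h
  smul_mem' z f hf n hn := by rw [fourierCoeff_lp_smul, hf n hn, mul_zero]

open Classical in
/-- The Riesz projection `P : ∑_{n ∈ ℤ} f_n tⁿ ↦ ∑_{n ≥ 0} f_n tⁿ`, as a bounded operator from `L^p`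
to `H^p`. Such an operator exists for `1 < p < ∞` by the theorem of M. Riesz, and it is unique
because a function in `L^p` is determined by its Fourier coefficients. (For `p = 1, ∞` there is none
and the value is `0`.) -/
def rieszP : LpT p →L[ℂ] Hardy p :=
  if h : ∃ P : LpT p →L[ℂ] Hardy p, ∀ (f : LpT p) (n : ℤ), 0 ≤ n →
      fourierCoeff (P f : LpT p) n = fourierCoeff f n
  then h.choose else 0

/-- The complementary projection `Q = I - P` on `L^p`. -/
def rieszQ : LpT p →L[ℂ] LpT p :=
  ContinuousLinearMap.id ℂ (LpT p) - (Hardy p).subtypeL ∘L rieszP p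

/-- Multiplication by `a ∈ L^∞` on `L^p`. -/
def mulOp (a : LInf) : LpT p →L[ℂ] LpT p :=
  (ContinuousLinearMap.mul ℂ ℂ).holderL arc ∞ p p a

/-- The flip `(J f)(t) = conj t * f (conj t)` on `L^p`. -/
def flipJ : LpT p →L[ℂ] LpT p :=
  mulOp p (fourierLp ∞ (-1)) ∘L
    (Lp.compMeasurePreservingₗᵢ ℂ (fun t : Torus => -t)
      measurePreserving_conj).toContinuousLinearMap

/-- The Toeplitz operator `T(a) f = P a f` on `H^p`. -/
def toeplitz (a : LInf) : Hardy p →L[ℂ] Hardy p :=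
  rieszP p ∘L mulOp p a ∘L (Hardy p).subtypeL

/-- The Hankel operator `H(a) f = P a Q J f` on `H^p`. -/
def hankel (a : LInf) : Hardy p →L[ℂ] Hardy p :=
  rieszP p ∘L mulOp p a ∘L rieszQ p ∘L flipJ p ∘L (Hardy p).subtypeL

end Operators

section Fredholm

variable {X : Type*} [NormedAddCommGroup X] [NormedSpace ℂ X]

/-- The Banach space adjoint `A^* h = h ∘ A` on the dual space `X^*`. -/
def adjointOp (A : X →L[ℂ] X) : StrongDual ℂ X →L[ℂ] StrongDual ℂ X :=
  (ContinuousLinearMap.compL ℂ X X ℂ).flip A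

/-- The index `dim ker A - dim ker A^*` (meaningful for Fredholm operators `A`). -/
def index (A : X →L[ℂ] X) : ℤ :=
  (Module.finrank ℂ A.ker : ℤ) - (Module.finrank ℂ (adjointOp A).ker : ℤ)

end Fredholm

end ToeplitzHankel

end

open ToeplitzHankel

noncomputable section

namespace ToeplitzHankel

/-! ### Operators on `L^p` of the circle -/

section Basics

variable (p : ℝ≥0∞) [Fact (1 ≤ p)]

/-! The matching relation turns inversion of `T(a) ± H(b)` into inversion of `T(d)` and `T(c)`, one
after the other, by explicit formulas. For `f ∈ H^p` put `s = a f + b J f` and `r = b̃ f + ã J f`.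
Since `d b̃ = a`, `d ã = b` and `J` turns multiplication by `ã`, `b̃` into multiplication by `a`,
`b`, both `d r = s` and `J r = s` hold. Moreover `P s = (T(a) + H(b)) f`, because `J` maps `H^p`
into `ker P` and `Q` in the Hankel operator is therefore redundant. The flip gives `r = J P s + P
r`, and then `d r = s` gives `T(d) P r = P s - P d J P s`. A left inverse of `T(d)` thus recovers
`r` from `P s`, and since `ã⁻¹ r = c f + J f`, a left inverse of `T(c)` recovers `f` from `P ã⁻¹ r =
T(c) f`. Right inverses come from solving the same relations backwards. This algebra is
`MatchingOperators.hasLeftInverse` and `MatchingOperators.hasRightInverse`; the sign of `H(b)` is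
changed by passing to `-b, -c, -d`.

It remains to make `T(c)` and `T(d)` one-sidedly invertible. By Coburn's lemma
(`denseRange_toeplitz`) a Toeplitz operator whose symbol vanishes almost nowhere is injective or has
dense range. A Fredholm operator has closed range, so the sign of the index decides: index `≥ 0`
gives surjectivity and index `≤ 0` injectivity, and the complements available for a Fredholm
operator give bounded inverses.

Two analytic facts support this. The theorem of M. Riesz (`norm_posPart_le`) makes `P` a genuine
bounded projection. For `1 < p ≤ 2` it follows from a pointwise inequality for powers in the right
half-plane and the mean value property, and for `p ≥ 2` by duality. Coburn's lemma needs that a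
nonzero function in `H^p` vanishes almost nowhere (`ae_ne_zero_of_hardy`), which comes from a
weighted Jensen inequality. -/

lemma coeFn_mulOp (a : LInf) (f : LpT p) :
    (mulOp p a f : Torus → ℂ) =ᵐ[arc] fun t => a t * f t := by
  simpa [mulOp] using (ContinuousLinearMap.mul ℂ ℂ).coeFn_holder (r := p) a f

lemma coeFn_lmul (a b : LInf) : (lmul a b : Torus → ℂ) =ᵐ[arc] fun t => a t * b t :=
  Lp.coeFn_lpSMul (r := ∞) a b

lemma coeFn_tilde (a : LInf) : (tilde a : Torus → ℂ) =ᵐ[arc] fun t => a (-t) :=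
  Lp.coeFn_compMeasurePreserving a measurePreserving_conj

lemma ae_neg {q : Torus → Prop} (h : ∀ᵐ t ∂arc, q t) : ∀ᵐ t ∂arc, q (-t) :=
  measurePreserving_conj.quasiMeasurePreserving.ae h

lemma coeFn_flipJ (f : LpT p) :
    (flipJ p f : Torus → ℂ) =ᵐ[arc] fun t => fourier (-1) t * f (-t) := by
  have h := coeFn_mulOp p (fourierLp ∞ (-1))
    (Lp.compMeasurePreserving (fun t : Torus => -t) measurePreserving_conj f)
  filter_upwards [h, coeFn_fourierLp (T := 2 * π) ∞ (-1),
    Lp.coeFn_compMeasurePreserving f measurePreserving_conj] with t h1 h2 h3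
  change (mulOp p (fourierLp ∞ (-1))
    (Lp.compMeasurePreserving (fun t : Torus => -t) measurePreserving_conj f)) t = _
  rw [h1, h2, h3]
  rfl

lemma flipJ_flipJ (f : LpT p) : flipJ p (flipJ p f) = f := by
  apply Lp.ext
  filter_upwards [coeFn_flipJ p (flipJ p f), ae_neg (coeFn_flipJ p f)] with t h1 h2
  rw [h1, h2, ← mul_assoc, neg_neg]
  have : (fourier (-1) t : ℂ) * fourier (-1) (-t) = 1 := by
    rw [fourier_apply, fourier_apply]
    simp [← Circle.coe_mul, ← AddCircle.toCircle_add]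
  rw [this, one_mul]

lemma mulOp_flipJ (a a' : LInf) (h : ∀ᵐ t ∂arc, a' t = a (-t)) (f : LpT p) :
    flipJ p (mulOp p a f) = mulOp p a' (flipJ p f) := by
  apply Lp.ext
  filter_upwards [coeFn_flipJ p (mulOp p a f), coeFn_flipJ p f, ae_neg (coeFn_mulOp p a f),
    coeFn_mulOp p a' (flipJ p f), h] with t h1 h2 h3 h4 h5
  rw [h1, h4, h3, h2, h5]
  ring

/-- The `n`-th Fourier coefficient as a bounded functional on `L^p`. -/
def coeffL (n : ℤ) : LpT p →L[ℂ] ℂ :=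
  LinearMap.mkContinuous
    { toFun := fun f => fourierCoeff f n
      map_add' := fun f g => fourierCoeff_lp_add p f g n
      map_smul' := fun z f => fourierCoeff_lp_smul p z f n } 1 (by
    intro f
    change ‖fourierCoeff f n‖ ≤ 1 * ‖f‖
    rw [one_mul, Lp.norm_def, fourierCoeff]
    refine (norm_integral_le_lintegral_norm _).trans ?_
    refine ENNReal.toReal_mono (Lp.eLpNorm_ne_top f) ?_
    calc _ = eLpNorm f 1 arc := by
          rw [eLpNorm_one_eq_lintegral_enorm]
          refine lintegral_congr fun t => ?_
          rw [norm_smul, fourier_apply, Circle.norm_coe, one_mul, ofReal_norm]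
      _ ≤ eLpNorm f p arc :=
          eLpNorm_le_eLpNorm_of_exponent_le Fact.out (Lp.aestronglyMeasurable f))

@[simp] lemma coeffL_apply (n : ℤ) (f : LpT p) : coeffL p n f = fourierCoeff f n := rfl

lemma mem_hardy {f : LpT p} : f ∈ Hardy p ↔ ∀ n : ℤ, n < 0 → fourierCoeff f n = 0 := Iff.rfl

lemma isClosed_hardy : IsClosed (Hardy p : Set (LpT p)) := by
  have : (Hardy p : Set (LpT p)) = ⋂ n : ℤ, ⋂ _ : n < 0, {f | coeffL p n f = 0} := by
    ext f
    simp [mem_hardy]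
  rw [this]
  exact isClosed_iInter fun n => isClosed_iInter fun _ =>
    isClosed_eq (coeffL p n).continuous continuous_const

instance completeSpace_hardy : CompleteSpace (Hardy p) :=
  (isClosed_hardy p).completeSpace_coe

lemma fourierCoeff_fourierLp (m n : ℤ) :
    fourierCoeff (fourierLp (T := 2 * π) p m) n = if n = m then 1 else 0 := by
  rw [fourierCoeff_congr_ae (coeFn_fourierLp (T := 2 * π) p m), fourierCoeff_fourier]
  simp [Pi.single_apply]

/-- Multiplication by the continuous function `φ`. -/
def mulC : C(Torus, ℂ) →L[ℂ] LpT p →L[ℂ] LpT p :=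
  (ContinuousLinearMap.mul ℂ ℂ).holderL arc ∞ p p ∘L ContinuousMap.toLp (E := ℂ) ∞ arc ℂ

lemma coeFn_mulC (φ : C(Torus, ℂ)) (f : LpT p) :
    (mulC p φ f : Torus → ℂ) =ᵐ[arc] fun t => φ t * f t := by
  filter_upwards [coeFn_mulOp p (ContinuousMap.toLp ∞ arc ℂ φ) f,
    ContinuousMap.coeFn_toLp (p := ∞) (𝕜 := ℂ) arc φ] with t h1 h2
  rw [← h2, ← h1]
  rfl

lemma fourierCoeff_mulC_fourier (m n : ℤ) (f : LpT p) :
    fourierCoeff (mulC p (fourier m) f) n = fourierCoeff f (n - m) := by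
  rw [fourierCoeff_congr_ae (coeFn_mulC p (fourier m) f), fourierCoeff, fourierCoeff]
  refine integral_congr_ae (.of_forall fun t => ?_)
  simp only [smul_eq_mul, ← mul_assoc]
  rw [← fourier_add]
  congr 2
  congr 1
  ring

/-- The factor `conj t` in the flip shifts the reflection by one, so that `n ↦ -1 - n` exchanges the
indices `n ≥ 0` and `n < 0` exactly. Hence `J` interchanges `H^p` and `ker P`. -/
lemma fourierCoeff_flipJ (n : ℤ) (f : LpT p) :
    fourierCoeff (flipJ p f) n = fourierCoeff f (-1 - n) := by
  rw [fourierCoeff_congr_ae (coeFn_flipJ p f), fourierCoeff, fourierCoeff,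
    ← measurePreserving_conj.integral_comp (MeasurableEquiv.neg Torus).measurableEmbedding]
  refine integral_congr_ae (.of_forall fun t => ?_)
  simp only [smul_eq_mul, ← mul_assoc, neg_neg]
  congr 1
  have (k : ℤ) : (fourier k (-t) : ℂ) = fourier (-k) t := by simp [fourier_apply]
  rw [this, this, ← fourier_add]
  congr 2
  ring

/-- The trigonometric polynomial with coefficients `x`. -/
def trigPoly : (ℤ →₀ ℂ) →ₗ[ℂ] C(Torus, ℂ) := Finsupp.linearCombination ℂ fourier

lemma denseRange_trigPoly : DenseRange trigPoly := by
  have h := span_fourier_closure_eq_top (T := 2 * π)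
  rw [← Finsupp.range_linearCombination] at h
  exact (LinearMap.range trigPoly).dense_iff_topologicalClosure_eq_top.2 h

/-- The trigonometric polynomial with coefficients `x`, as an element of `L^p`. -/
def trigLp : (ℤ →₀ ℂ) →ₗ[ℂ] LpT p :=
  (ContinuousMap.toLp (E := ℂ) p arc ℂ).toLinearMap ∘ₗ trigPoly

lemma coeFn_trigLp (x : ℤ →₀ ℂ) : (trigLp p x : Torus → ℂ) =ᵐ[arc] trigPoly x :=
  ContinuousMap.coeFn_toLp arc (trigPoly x)

lemma denseRange_trigLp (hp : p ≠ ∞) : DenseRange (trigLp p) :=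
  (ContinuousMap.toLp_denseRange ℂ arc ℂ hp).comp denseRange_trigPoly
    (ContinuousMap.toLp (E := ℂ) p arc ℂ).continuous

@[simp] lemma trigLp_single (n : ℤ) (z : ℂ) :
    trigLp p (Finsupp.single n z) = z • fourierLp p n := by
  simp [trigLp, trigPoly]

lemma fourierCoeff_trigLp (x : ℤ →₀ ℂ) (n : ℤ) : fourierCoeff (trigLp p x) n = x n := by
  rw [← coeffL_apply]
  induction x using Finsupp.induction_linear with
  | zero => rw [map_zero, map_zero, Finsupp.zero_apply]
  | add f g hf hg => rw [map_add, map_add, hf, hg, Finsupp.add_apply]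
  | single m z =>
    rw [trigLp_single, map_smul, coeffL_apply, fourierCoeff_fourierLp, Finsupp.single_apply]
    simp [eq_comm]

/-- A function in `L^p` is determined by its Fourier coefficients. -/
lemma eq_zero_of_fourierCoeff (f : LpT p) (h : ∀ n, fourierCoeff f n = 0) : f = 0 := by
  -- The function integrates to zero against every trigonometric polynomial, hence by uniform
  -- density against every continuous function.
  have key (φ : C(Torus, ℂ)) : coeffL p 0 (mulC p φ f) = 0 := by
    let Λ : C(Torus, ℂ) →L[ℂ] ℂ := coeffL p 0 ∘L (mulC p).flip f
    refine denseRange_trigPoly.induction_on (p := fun φ => Λ φ = 0) φ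
      (isClosed_eq Λ.continuous continuous_const) fun x => ?_
    induction x using Finsupp.induction_linear with
    | zero => simp
    | add x y hx hy => rw [map_add, map_add, hx, hy, add_zero]
    | single m z =>
      rw [trigPoly, Finsupp.linearCombination_single, map_smul]
      change z • fourierCoeff (mulC p (fourier m) f) 0 = 0
      rw [fourierCoeff_mulC_fourier, h, smul_zero]
  have hint := integrable_coe p f
  refine (Lp.eq_zero_iff_ae_eq_zero).2 (ae_eq_zero_of_forall_setIntegral_isClosed_eq_zero hint
    fun s hs => ?_)
  -- The indicator of a closed set is a bounded pointwise limit of continuous functions, so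
  -- integrals over closed sets vanish too.
  have hlim : Filter.Tendsto (fun n => ∫ t, ((hs.apprSeq n t : ℝ) : ℂ) * f t ∂arc) Filter.atTop
      (nhds (∫ t, s.indicator f t ∂arc)) := by
    refine tendsto_integral_of_dominated_convergence (fun t => ‖f t‖) (fun n => ?_) hint.norm
      (fun n => .of_forall fun t => ?_) (.of_forall fun t => ?_)
    · exact (Continuous.aestronglyMeasurable (by fun_prop)).mul hint.1
    · rw [norm_mul, Complex.norm_real, NNReal.norm_eq]
      exact mul_le_of_le_one_left (norm_nonneg _) (HasOuterApproxClosed.apprSeq_apply_le_one hs n t)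
    · have h1 := (tendsto_pi_nhds.1 (HasOuterApproxClosed.tendsto_apprSeq hs)) t
      have h2 : s.indicator f t = (((s.indicator 1 t : NNReal) : ℝ) : ℂ) * f t := by
        by_cases ht : t ∈ s <;> simp [ht]
      rw [h2]
      exact ((((Complex.continuous_ofReal.comp NNReal.continuous_coe).tendsto _).comp h1).mul_const _)
  rw [← integral_indicator hs.measurableSet]
  refine tendsto_nhds_unique hlim ?_
  have h0 (n : ℕ) : ∫ t, ((hs.apprSeq n t : ℝ) : ℂ) * f t ∂arc = 0 := by
    rw [← key ⟨fun t => ((hs.apprSeq n t : ℝ) : ℂ), by fun_prop⟩, coeffL_apply,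
      fourierCoeff_congr_ae (coeFn_mulC p _ f), fourierCoeff]
    simp
  simp only [h0]
  exact tendsto_const_nhds

lemma ext_fourierCoeff {f g : LpT p} (h : ∀ n, fourierCoeff f n = fourierCoeff g n) : f = g := by
  rw [← sub_eq_zero]
  refine eq_zero_of_fourierCoeff p _ fun n => ?_
  rw [← coeffL_apply, map_sub, coeffL_apply, coeffL_apply, h, sub_self]

end Basics

/-! ### Factorisation through the matching functions -/

section Factorisation

variable {E H : Type*} [NormedAddCommGroup E] [NormedSpace ℂ E] [NormedAddCommGroup H]
  [NormedSpace ℂ H]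

/-- The algebraic relations between multiplication by `a, ã, b, b̃, c, d, ã⁻¹` (the operators
`A, A', B, B', C, D, W`), a projection `ι R`, and a flip `J` interchanging `ι R` and `1 - ι R`. -/
structure MatchingOperators (R : E →L[ℂ] H) (ι : H →L[ℂ] E) (J A A' B B' C D W : E →L[ℂ] E) :
    Prop where
  proj : ∀ h, R (ι h) = h
  proj_flip : ∀ h, R (J (ι h)) = 0
  flip_compl : ∀ f, R f = 0 → ι (R (J f)) = J f
  flip_flip : ∀ f, J (J f) = f
  flip_A' : ∀ f, J (A' f) = A (J f)
  flip_B' : ∀ f, J (B' f) = B (J f)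
  D_B' : ∀ f, D (B' f) = A f
  D_A' : ∀ f, D (A' f) = B f
  W_B' : ∀ f, W (B' f) = C f
  W_A' : ∀ f, W (A' f) = f
  A'_W : ∀ f, A' (W f) = f
  A'_C : ∀ f, A' (C f) = B' f

variable {R : E →L[ℂ] H} {ι : H →L[ℂ] E} {J A A' B B' C D W : E →L[ℂ] E}

namespace MatchingOperators

/-- The pair `(a, -b)` is again matching, with matching functions `-c` and `-d`; this reduces `T(a)
- H(b)` to `T(a) + H(b)`. -/
lemma neg (h : MatchingOperators R ι J A A' B B' C D W) :
    MatchingOperators R ι J A A' (-B) (-B') (-C) (-D) W where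
  proj := h.proj
  proj_flip := h.proj_flip
  flip_compl := h.flip_compl
  flip_flip := h.flip_flip
  flip_A' := h.flip_A'
  flip_B' f := by simp [h.flip_B']
  D_B' f := by simp [h.D_B']
  D_A' f := by simp [h.D_A']
  W_B' f := by simp [h.W_B']
  W_A' := h.W_A'
  A'_W := h.A'_W
  A'_C f := by simp [h.A'_C]

theorem hasLeftInverse (h : MatchingOperators R ι J A A' B B' C D W)
    (hC : (R ∘L C ∘L ι).HasLeftInverse) (hD : (R ∘L D ∘L ι).HasLeftInverse) :
    (R ∘L (A + B ∘L J) ∘L ι).HasLeftInverse := by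
  obtain ⟨Lc, hLc⟩ := hC
  obtain ⟨Ld, hLd⟩ := hD
  -- The inner bracket reconstructs `r` from `R s`: the summand `J ι R s` is its part in `ker R`,
  -- and `Ld` finds `R r`.
  refine ⟨Lc ∘L R ∘L W ∘L (J ∘L ι + ι ∘L Ld ∘L (.id ℂ H - R ∘L D ∘L J ∘L ι)), fun f => ?_⟩
  set r := B' (ι f) + A' (J (ι f)) with hr
  set s := A (ι f) + B (J (ι f)) with hs
  have hDr : D r = s := by rw [hr, map_add, h.D_B', h.D_A']
  have hJr : J r = s := by rw [hr, map_add, h.flip_A', h.flip_B', h.flip_flip, add_comm]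
  have hJs : J s = r := by rw [← hJr, h.flip_flip]
  have hWr : W r = C (ι f) + J (ι f) := by rw [hr, map_add, h.W_B', h.W_A']
  -- The remainder `s - ι (R s)` lies in `ker R`, so its flip `r - J (ι (R s))` lies in the range of
  -- `ι`; as `R` kills `J ∘ ι`, it equals `ι (R r)`.
  have hr' : J (ι (R s)) + ι (R r) = r := by
    have h1 := h.flip_compl (s - ι (R s)) (by rw [map_sub, h.proj, sub_self])
    rw [map_sub, map_sub, h.proj_flip, hJs, sub_zero] at h1
    rw [h1]
    abel
  have hLdr : Ld (R s - R (D (J (ι (R s))))) = R r := by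
    have h1 : R s - R (D (J (ι (R s)))) = R (D (ι (R r))) := by
      rw [← hDr, ← map_sub, ← map_sub, hDr]
      congr 2
      rw [sub_eq_iff_eq_add', hr']
    rw [h1]
    exact hLd (R r)
  calc _ = Lc (R (W (J (ι (R s)) + ι (Ld (R s - R (D (J (ι (R s))))))))) := rfl
    _ = Lc (R (C (ι f))) := by rw [hLdr, hr', hWr, map_add, h.proj_flip, add_zero]
    _ = f := hLc f

theorem hasRightInverse (h : MatchingOperators R ι J A A' B B' C D W)
    (hC : (R ∘L C ∘L ι).HasRightInverse) (hD : (R ∘L D ∘L ι).HasRightInverse) :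
    (R ∘L (A + B ∘L J) ∘L ι).HasRightInverse := by
  obtain ⟨Rc, hRc⟩ := hC
  obtain ⟨Rd, hRd⟩ := hD
  -- The function `ρ g` plays the role of `r`: it is built so that both `R (D (ρ g))` and `R (J (ρ
  -- g))` equal `g`.
  let ρ : H →L[ℂ] E := J ∘L ι + ι ∘L Rd ∘L (.id ℂ H - R ∘L D ∘L J ∘L ι)
  let X : H →L[ℂ] H := Rc ∘L R ∘L W ∘L ρ
  -- With `x = X g`, the function `y' = ã⁻¹ ρ - c x` lies in `ker R`, hence is the flip of some `y`
  -- in `H`. Then `a x + b J y = d ρ` and `a y + b J x = J ρ`; adding these and applying `R` sends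
  -- `x + y` to `2 g`, whence the factor one half.
  refine ⟨(2⁻¹ : ℂ) • (X + R ∘L J ∘L (W ∘L ρ - C ∘L ι ∘L X)), fun g => ?_⟩
  have hRDρ : R (D (ρ g)) = g := by
    have h1 : R (D (ι (Rd (g - R (D (J (ι g))))))) = g - R (D (J (ι g))) := hRd _
    change R (D (J (ι g) + ι (Rd (g - R (D (J (ι g))))))) = g
    rw [map_add, map_add, h1]
    abel
  have hRJρ : R (J (ρ g)) = g := by
    change R (J (J (ι g) + ι (Rd (g - R (D (J (ι g))))))) = g
    rw [map_add, map_add, h.flip_flip, h.proj, h.proj_flip, add_zero]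
  set x := X g with hx
  set y' := W (ρ g) - C (ι x) with hy'
  have hxR : R (C (ι x)) = R (W (ρ g)) := hRc _
  have hy : ι (R (J y')) = J y' := h.flip_compl y' (by rw [hy', map_sub, hxR, sub_self])
  have hr : B' (ι x) + A' y' = ρ g := by
    rw [hy', map_sub, h.A'_W, h.A'_C]
    abel
  have e1 : A (ι x) + B y' = D (ρ g) := by rw [← hr, map_add, h.D_B', h.D_A']
  have e2 : A (J y') + B (J (ι x)) = J (ρ g) := by
    rw [← hr, map_add, h.flip_A', h.flip_B', add_comm]
  set y := R (J y') with hyd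
  calc _ = R (A (ι ((2⁻¹ : ℂ) • (x + y))) + B (J (ι ((2⁻¹ : ℂ) • (x + y))))) := rfl
    _ = (2⁻¹ : ℂ) • R ((A (ι x) + B (J (ι y))) + (A (ι y) + B (J (ι x)))) := by
      simp only [map_smul, map_add, ← smul_add]
      congr 1
      abel
    _ = (2⁻¹ : ℂ) • (g + g) := by rw [hy, h.flip_flip, e1, e2, map_add, hRDρ, hRJρ]
    _ = g := by rw [← two_smul ℂ g, smul_smul]; norm_num

end MatchingOperators

end Factorisation

/-! ### Trigonometric polynomials -/

section TrigPoly

lemma trigPoly_single (n : ℤ) (z : ℂ) : trigPoly (Finsupp.single n z) = z • fourier n := by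
  simp [trigPoly]

lemma fourierCoeff_trigPoly (x : ℤ →₀ ℂ) (n : ℤ) : fourierCoeff (trigPoly x) n = x n := by
  rw [← fourierCoeff_trigLp 1 x, fourierCoeff_congr_ae (coeFn_trigLp 1 x)]

lemma trigPoly_injective : Function.Injective trigPoly := fun x y h => by
  ext n
  rw [← fourierCoeff_trigPoly, h, fourierCoeff_trigPoly]

/-- The projection `∑ xₙ tⁿ ↦ ∑_{n ≥ 0} xₙ tⁿ` on coefficients. -/
def posPart : (ℤ →₀ ℂ) →ₗ[ℂ] (ℤ →₀ ℂ) where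
  toFun := Finsupp.filter (0 ≤ ·)
  map_add' _ _ := Finsupp.filter_add
  map_smul' _ _ := Finsupp.filter_smul

lemma posPart_apply (x : ℤ →₀ ℂ) (n : ℤ) : posPart x n = if 0 ≤ n then x n else 0 :=
  Finsupp.filter_apply _ _ _

lemma posPart_single (n : ℤ) (z : ℂ) :
    posPart (Finsupp.single n z) = if 0 ≤ n then Finsupp.single n z else 0 := by
  ext m
  rw [posPart_apply]
  by_cases h : n = m
  · subst h; split_ifs <;> simp
  · split_ifs <;> simp [Finsupp.single_eq_of_ne' h]

/-- The coefficients of the complex conjugate of a trigonometric polynomial. -/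
def conjCoeff (x : ℤ →₀ ℂ) : ℤ →₀ ℂ :=
  Finsupp.equivMapDomain (Equiv.neg ℤ) (x.mapRange (starRingEnd ℂ) (map_zero _))

lemma conjCoeff_apply (x : ℤ →₀ ℂ) (n : ℤ) : conjCoeff x n = starRingEnd ℂ (x (-n)) := by
  simp [conjCoeff]

lemma trigPoly_conjCoeff (x : ℤ →₀ ℂ) : trigPoly (conjCoeff x) = star (trigPoly x) := by
  induction x using Finsupp.induction_linear with
  | zero =>
    have : conjCoeff 0 = 0 := by ext; simp [conjCoeff_apply]
    rw [this, map_zero, star_zero]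
  | add x y hx hy =>
    have : conjCoeff (x + y) = conjCoeff x + conjCoeff y := by ext; simp [conjCoeff_apply]
    rw [this, map_add, hx, hy, map_add, star_add]
  | single n z =>
    have : conjCoeff (Finsupp.single n z) = Finsupp.single (-n) (starRingEnd ℂ z) := by
      ext m
      rw [conjCoeff_apply, Finsupp.single_apply, Finsupp.single_apply, apply_ite (starRingEnd ℂ),
        map_zero]
      simp only [eq_neg_iff_add_eq_zero, neg_eq_iff_add_eq_zero]
    rw [this, trigPoly_single, trigPoly_single, star_smul]
    ext t
    simp

lemma integrable_continuousMap {F : Type*} [NormedAddCommGroup F] {φ : Torus → F}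
    (h : Continuous φ) : Integrable φ arc := by
  simpa using h.continuousOn.integrableOn_compact (μ := arc) isCompact_univ

lemma memLp_continuousMap (p : ℝ≥0∞) (φ : C(Torus, ℂ)) : MemLp φ p arc :=
  (MemLp.of_bound φ.continuous.aestronglyMeasurable ‖φ‖ (.of_forall φ.norm_coe_le_norm)).mono_exponent
    le_top

lemma integral_trigPoly_mul_conj (x : ℤ →₀ ℂ) (n : ℤ) (z : ℂ) :
    ∫ t, trigPoly (Finsupp.single n z) t * starRingEnd ℂ (trigPoly x t) ∂arc =
      z * starRingEnd ℂ (x n) := by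
  rw [← fourierCoeff_trigPoly, fourierCoeff, ← integral_conj, ← integral_const_mul]
  refine integral_congr_ae (.of_forall fun t => ?_)
  simp [trigPoly_single, mul_assoc]

/-- The coefficient projection is symmetric for the `L²` pairing. -/
lemma integral_posPart_mul_conj (x y : ℤ →₀ ℂ) :
    ∫ t, trigPoly (posPart x) t * starRingEnd ℂ (trigPoly y t) ∂arc =
      ∫ t, trigPoly x t * starRingEnd ℂ (trigPoly (posPart y) t) ∂arc := by
  have hi (u v : C(Torus, ℂ)) : Integrable (fun t => u t * starRingEnd ℂ (v t)) arc :=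
    integrable_continuousMap (by fun_prop)
  induction x using Finsupp.induction_linear with
  | zero => simp
  | add a b ha hb =>
    simp only [map_add, ContinuousMap.add_apply, add_mul]
    rw [integral_add (hi _ _) (hi _ _), integral_add (hi _ _) (hi _ _), ha, hb]
  | single n z =>
    rw [integral_trigPoly_mul_conj, posPart_single, posPart_apply]
    split_ifs with h
    · exact integral_trigPoly_mul_conj y n z
    · simp

/-- The algebraic polynomial `∑_{n ≥ 0} xₙ Xⁿ`. -/
def toPoly (x : ℤ →₀ ℂ) : Polynomial ℂ :=
  x.sum fun n z => if 0 ≤ n then Polynomial.monomial n.toNat z else 0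

lemma toAddCircle_toPoly (x : ℤ →₀ ℂ) :
    (toPoly x).toAddCircle = trigPoly (posPart x) := by
  induction x using Finsupp.induction_linear with
  | zero => simp [toPoly]
  | add x y hx hy =>
    have : toPoly (x + y) = toPoly x + toPoly y :=
      Finsupp.sum_add_index' (by simp) (by intros; split_ifs <;> simp)
    rw [this, map_add, hx, hy, map_add, map_add]
  | single n z =>
    rw [toPoly, Finsupp.sum_single_index (by simp), posPart_single]
    split_ifs with h
    · rw [Polynomial.toAddCircle_monomial_eq_smul_fourier, trigPoly_single, Int.toNat_of_nonneg h]
    · simp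

lemma eval_toPoly (x : ℤ →₀ ℂ) (t : Torus) :
    (toPoly x).eval (fourier 1 t) = trigPoly (posPart x) t := by
  rw [← toAddCircle_toPoly]
  simp [Polynomial.toAddCircle, Polynomial.aeval_def, Polynomial.eval₂_eq_sum,
    Polynomial.eval_eq_sum, Polynomial.sum_def, fourier_apply]

lemma coeff_zero_toPoly (x : ℤ →₀ ℂ) : (toPoly x).coeff 0 = x 0 := by
  rw [← Polynomial.fourierCoeff_toAddCircle_natCast, toAddCircle_toPoly, Nat.cast_zero,
    fourierCoeff_trigPoly, posPart_apply, if_pos le_rfl]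

lemma circleAverage_eq_integral {F : Type*} [NormedAddCommGroup F] [NormedSpace ℝ F]
    (g : ℂ → F) : Real.circleAverage g 0 1 = ∫ t, g (fourier 1 t) ∂arc := by
  rw [AddCircle.integral_haarAddCircle, Real.circleAverage,
    ← AddCircle.intervalIntegral_preimage (2 * π) 0]
  simp [AddCircle.toCircle, circleMap]

end TrigPoly

/-! ### Norms of continuous functions in `L^p` -/

section Norms

variable (p : ℝ≥0∞) [Fact (1 ≤ p)]

lemma norm_toLp_rpow (hp : p ≠ ∞) (φ : C(Torus, ℂ)) :
    ‖ContinuousMap.toLp (E := ℂ) p arc ℂ φ‖ ^ p.toReal = ∫ t, ‖φ t‖ ^ p.toReal ∂arc := by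
  have h1 : p ≠ 0 := (zero_lt_one.trans_le Fact.out).ne'
  rw [Lp.norm_def, eLpNorm_congr_ae (ContinuousMap.coeFn_toLp arc φ),
    (memLp_continuousMap p φ).eLpNorm_eq_integral_rpow_norm h1 hp, ENNReal.toReal_ofReal (by positivity),
    Real.rpow_inv_rpow (by positivity) (ENNReal.toReal_ne_zero.2 ⟨h1, hp⟩)]

lemma norm_toLp_mono {φ ψ : C(Torus, ℂ)} (h : ∀ t, ‖φ t‖ ≤ ‖ψ t‖) :
    ‖ContinuousMap.toLp (E := ℂ) p arc ℂ φ‖ ≤ ‖ContinuousMap.toLp (E := ℂ) p arc ℂ ψ‖ := by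
  refine Lp.norm_le_norm_of_ae_le ?_
  filter_upwards [ContinuousMap.coeFn_toLp (p := p) (𝕜 := ℂ) arc φ,
    ContinuousMap.coeFn_toLp (p := p) (𝕜 := ℂ) arc ψ] with t h1 h2
  rw [h1, h2]
  exact h t

lemma norm_toLp_const (z : ℂ) :
    ‖ContinuousMap.toLp (E := ℂ) p arc ℂ (ContinuousMap.const _ z)‖ ≤ ‖z‖ := by
  refine (Lp.norm_le_of_ae_bound (C := ‖z‖) (norm_nonneg z) ?_).trans ?_
  · filter_upwards [ContinuousMap.coeFn_toLp (p := p) (𝕜 := ℂ) arc (ContinuousMap.const _ z)]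
      with t h1
    rw [h1]
    rfl
  · simp [measureUnivNNReal]

/-- The circle has total mass one, so a uniform error `δ` costs at most `δ` in the `L^p` norm. -/
lemma norm_toLp_le_add {φ ψ : C(Torus, ℂ)} {δ : ℝ} (hδ : 0 ≤ δ) (h : ∀ t, ‖φ t‖ ≤ ‖ψ t‖ + δ) :
    ‖ContinuousMap.toLp (E := ℂ) p arc ℂ φ‖ ≤ ‖ContinuousMap.toLp (E := ℂ) p arc ℂ ψ‖ + δ := by
  let ψ' : C(Torus, ℂ) := ⟨fun t => (‖ψ t‖ : ℂ), by fun_prop⟩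
  calc _ ≤ ‖ContinuousMap.toLp (E := ℂ) p arc ℂ (ψ' + ContinuousMap.const _ (δ : ℂ))‖ := by
        refine norm_toLp_mono p fun t => (h t).trans ?_
        change _ ≤ ‖((‖ψ t‖ : ℂ) + (δ : ℂ))‖
        rw [← Complex.ofReal_add, Complex.norm_real]
        exact le_abs_self _
    _ ≤ ‖ContinuousMap.toLp (E := ℂ) p arc ℂ ψ'‖ + δ := by
        rw [map_add]
        refine (norm_add_le _ _).trans (add_le_add le_rfl ((norm_toLp_const p _).trans ?_))
        rw [Complex.norm_real, Real.norm_of_nonneg hδ]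
    _ ≤ _ := by
        gcongr
        exact norm_toLp_mono p fun t => by simp [ψ']

lemma norm_integral_le_norm_toLp (φ : C(Torus, ℂ)) :
    ‖∫ t, φ t ∂arc‖ ≤ ‖ContinuousMap.toLp (E := ℂ) p arc ℂ φ‖ := by
  have h := (coeffL p 0).le_of_opNorm_le (LinearMap.mkContinuous_norm_le _ zero_le_one _)
    (ContinuousMap.toLp (E := ℂ) p arc ℂ φ)
  rw [one_mul, coeffL_apply, fourierCoeff_congr_ae (ContinuousMap.coeFn_toLp arc φ),
    fourierCoeff] at h
  simpa using h

end Norms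

/-! ### The theorem of M. Riesz -/

section Riesz

/-- Away from the imaginary axis `‖z‖` is comparable to `re z`; near it `s * |arg z|` lies beyond `π
/ 2`, and so `re (z ^ s)` is negative and comparable to `-‖z‖ ^ s`. On the circle the term with `z ^
s` can be integrated exactly. -/
lemma norm_rpow_le_of_re_pos {s : ℝ} (h1 : 1 < s) (h2 : s ≤ 2) :
    ∃ A B : ℝ, 0 ≤ A ∧ 0 ≤ B ∧ ∀ z : ℂ, 0 < z.re →
      ‖z‖ ^ s ≤ A * z.re ^ s - B * (z ^ (s : ℂ)).re := by
  have hπ := Real.pi_pos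
  -- The separating angle is the midpoint of `π / (2 s)` and `π / 2`, which makes `cos θ > 0` and
  -- `cos (s θ) < 0`.
  set θ := (π / (2 * s) + π / 2) / 2 with hθ
  have hs : π / (2 * s) < π / 2 := by
    apply div_lt_div_of_pos_left hπ (by norm_num) (by linarith)
  have hs' : 0 < π / (2 * s) := by positivity
  have hsθ : π / 2 < s * θ := by
    have h3 : s * (π / (2 * s)) = π / 2 := by field_simp
    rw [← h3]
    exact mul_lt_mul_of_pos_left (by linarith) (by linarith)
  have hsθ' : s * θ < π := by nlinarith
  have hcθ : 0 < Real.cos θ := Real.cos_pos_of_mem_Ioo ⟨by linarith, by linarith⟩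
  have hcs : Real.cos (s * θ) < 0 :=
    Real.cos_neg_of_pi_div_two_lt_of_lt hsθ (by linarith)
  set B := (-Real.cos (s * θ))⁻¹ with hB
  have hBpos : 0 < B := by rw [hB]; exact inv_pos.2 (by linarith)
  have hcpos : 0 < Real.cos θ ^ s := Real.rpow_pos_of_pos hcθ s
  refine ⟨(1 + B) / Real.cos θ ^ s, B, by positivity, hBpos.le, fun z hz => ?_⟩
  have hz0 : z ≠ 0 := fun h => by simp [h] at hz
  have hn : 0 < ‖z‖ := norm_pos_iff.2 hz0
  set φ := |z.arg| with hφ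
  have hφ2 : φ < π / 2 := Complex.abs_arg_lt_pi_div_two_iff.2 (Or.inl hz)
  have hφ0 : 0 ≤ φ := abs_nonneg _
  have hre : z.re = ‖z‖ * Real.cos φ := by
    rw [hφ, Real.cos_abs, Complex.norm_mul_cos_arg]
  have hcφ : 0 < Real.cos φ := Real.cos_pos_of_mem_Ioo ⟨by linarith, hφ2⟩
  have hpow : (z ^ (s : ℂ)).re = ‖z‖ ^ s * Real.cos (s * φ) := by
    rw [Complex.cpow_def_of_ne_zero hz0, Complex.exp_re]
    simp only [Complex.mul_re, Complex.mul_im, Complex.log_re, Complex.log_im, Complex.ofReal_re,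
      Complex.ofReal_im, mul_zero, sub_zero, zero_add]
    rw [Real.rpow_def_of_pos hn, hφ, ← Real.cos_abs (z.arg * s), abs_mul,
      abs_of_pos (by linarith : 0 < s), mul_comm |z.arg|]
  rw [hpow, hre, Real.mul_rpow hn.le hcφ.le]
  have key : 1 ≤ (1 + B) / Real.cos θ ^ s * Real.cos φ ^ s - B * Real.cos (s * φ) := by
    rcases le_total φ θ with h | h
    · have h3 : Real.cos θ ^ s ≤ Real.cos φ ^ s :=
        Real.rpow_le_rpow hcθ.le (Real.cos_le_cos_of_nonneg_of_le_pi hφ0 (by linarith) h)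
          (by linarith)
      have h4 : 1 + B ≤ (1 + B) / Real.cos θ ^ s * Real.cos φ ^ s := by
        rw [div_mul_eq_mul_div, le_div_iff₀ hcpos]
        gcongr
      have h5 := mul_le_mul_of_nonneg_left (Real.cos_le_one (s * φ)) hBpos.le
      linarith
    · have h3 : Real.cos (s * φ) ≤ Real.cos (s * θ) :=
        Real.cos_le_cos_of_nonneg_of_le_pi (by nlinarith) (by nlinarith) (by gcongr)
      have h4 := mul_le_mul_of_nonneg_left h3 hBpos.le
      have h5 : B * Real.cos (s * θ) = -1 := by
        rw [hB, inv_mul_eq_div, div_eq_iff (by linarith)]; ring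
      have h6 : 0 ≤ (1 + B) / Real.cos θ ^ s * Real.cos φ ^ s := by positivity
      linarith
  calc ‖z‖ ^ s = ‖z‖ ^ s * 1 := (mul_one _).symm
    _ ≤ ‖z‖ ^ s * ((1 + B) / Real.cos θ ^ s * Real.cos φ ^ s - B * Real.cos (s * φ)) := by gcongr
    _ = _ := by ring

/-- Minimum principle for `re q`: apply the maximum modulus principle to `exp (-q)`, whose modulus
is `exp (-re q)`. -/
lemma re_eval_pos (q : Polynomial ℂ) (h : ∀ t : Torus, 0 < (q.eval (fourier 1 t)).re) {z : ℂ}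
    (hz : ‖z‖ ≤ 1) : 0 < (q.eval z).re := by
  obtain ⟨t₀, -, ht₀⟩ := isCompact_univ.exists_isMinOn (s := (univ : Set Torus)) univ_nonempty
    (f := fun t => (q.eval (fourier 1 t)).re) (by fun_prop)
  have hb : ∀ w ∈ frontier (Metric.ball (0 : ℂ) 1),
      ‖Complex.exp (-q.eval w)‖ ≤ Real.exp (-(q.eval (fourier 1 t₀)).re) := by
    intro w hw
    rw [frontier_ball _ one_ne_zero, mem_sphere_zero_iff_norm] at hw
    have hw' : w = fourier 1 ((w.arg : ℝ) : Torus) := by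
      rw [fourier_coe_apply]
      conv_lhs => rw [← Complex.norm_mul_exp_arg_mul_I w, hw]
      rw [Complex.ofReal_one, one_mul]
      congr 1
      have := Real.pi_ne_zero
      push_cast
      field_simp
    rw [Complex.norm_exp, Complex.neg_re, Real.exp_le_exp, neg_le_neg_iff, hw']
    exact isMinOn_iff.1 ht₀ _ (mem_univ _)
  have hd : DiffContOnCl ℂ (fun w => Complex.exp (-q.eval w)) (Metric.ball (0 : ℂ) 1) :=
    (q.differentiable.neg.cexp).diffContOnCl
  have h3 := Complex.norm_le_of_forall_mem_frontier_norm_le Metric.isBounded_ball hd hb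
    (z := z) (by rw [closure_ball _ one_ne_zero]; simpa using hz)
  rw [Complex.norm_exp, Complex.neg_re, Real.exp_le_exp, neg_le_neg_iff] at h3
  exact (h t₀).trans_le h3

variable (p : ℝ≥0∞) [Fact (1 ≤ p)]

/-- A positive trigonometric polynomial is the real part of an analytic polynomial `q` with values
in the right half-plane. Integrating the pointwise inequality for powers bounds `‖q‖_p`, and the
projection is `(q + x 0) / 2`. -/
lemma norm_posPart_le_of_pos (h1 : 1 < p) (h2 : p ≤ 2) :
    ∃ C : ℝ, 0 ≤ C ∧ ∀ x : ℤ →₀ ℂ,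
      (∀ t, (trigPoly x t).im = 0 ∧ 0 < (trigPoly x t).re) →
        ‖trigLp p (posPart x)‖ ≤ C * ‖trigLp p x‖ := by
  have hp : p ≠ ∞ := ne_top_of_le_ne_top (by simp) h2
  set s := p.toReal with hs
  have hs1 : 1 < s := by simpa using (ENNReal.toReal_lt_toReal (by simp) hp).2 h1
  have hs2 : s ≤ 2 := by simpa using (ENNReal.toReal_le_toReal hp (by simp)).2 h2
  have hs0 : 0 < s := by linarith
  obtain ⟨A, B, hA, hB, hAB⟩ := norm_rpow_le_of_re_pos hs1 hs2
  refine ⟨A ^ s⁻¹ + 1, by positivity, fun x hx => ?_⟩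
  -- the analytic completion of `v`
  set q : Polynomial ℂ := 2 * toPoly x - Polynomial.C (x 0) with hq
  have hconj : conjCoeff x = x := trigPoly_injective (by
    rw [trigPoly_conjCoeff]
    ext t
    exact Complex.conj_eq_iff_im.2 (hx t).1)
  have hq1 (t : Torus) : q.eval (fourier 1 t) = 2 * trigPoly (posPart x) t - x 0 := by
    rw [← eval_toPoly, hq, Polynomial.eval_sub, Polynomial.eval_mul, Polynomial.eval_C,
      Polynomial.eval_ofNat]
  have hsum : posPart x + conjCoeff (posPart x) = x + Finsupp.single 0 (x 0) := by
    ext n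
    have hn : starRingEnd ℂ (x (-n)) = x n := by rw [← conjCoeff_apply, hconj]
    rw [Finsupp.add_apply, Finsupp.add_apply, conjCoeff_apply, posPart_apply, posPart_apply,
      apply_ite (starRingEnd ℂ), hn, map_zero]
    rcases lt_trichotomy n 0 with h | h | h
    · rw [if_neg (by omega), if_pos (by omega), Finsupp.single_eq_of_ne (by omega)]; simp
    · subst h; simp
    · rw [if_pos h.le, if_neg (by omega), Finsupp.single_eq_of_ne (by omega)]
  have hre (t : Torus) : (q.eval (fourier 1 t)).re = (trigPoly x t).re := by
    have h3 := congrArg (fun y => (trigPoly y t).re) hsum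
    simp only [map_add, trigPoly_conjCoeff, trigPoly_single, ContinuousMap.add_apply,
      ContinuousMap.star_apply, ContinuousMap.smul_apply, fourier_zero, Complex.add_re,
      Complex.star_def, Complex.conj_re, smul_eq_mul, mul_one] at h3
    rw [hq1]
    simp only [Complex.sub_re, Complex.mul_re, Complex.re_ofNat, Complex.im_ofNat, zero_mul,
      sub_zero]
    linarith
  have hqpos {z : ℂ} (hz : ‖z‖ ≤ 1) : 0 < (q.eval z).re :=
    re_eval_pos q (fun t => by rw [hre]; exact (hx t).2) hz
  have hx0 : q.eval 0 = x 0 := by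
    rw [← Polynomial.coeff_zero_eq_eval_zero, hq]
    simp [coeff_zero_toPoly]
    ring
  -- Since `re q > 0` on the closed disc, the principal branch `q ^ s` is holomorphic there and has
  -- the mean value property.
  have hmean : ∫ t, (q.eval (fourier 1 t)) ^ (s : ℂ) ∂arc = x 0 ^ (s : ℂ) := by
    rw [← circleAverage_eq_integral fun z => (q.eval z) ^ (s : ℂ), ← hx0]
    refine DiffContOnCl.circleAverage (DifferentiableOn.diffContOnCl ?_)
    rw [abs_one, closure_ball _ one_ne_zero]
    intro z hz
    have hz' := hqpos (mem_closedBall_zero_iff.1 hz)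
    exact (q.differentiable z).differentiableWithinAt.cpow
      (differentiableWithinAt_const _) (Or.inl hz')
  have hint : x 0 = ((∫ t, (trigPoly x t).re ∂arc : ℝ) : ℂ) := by
    rw [← fourierCoeff_trigPoly, fourierCoeff, ← integral_complex_ofReal]
    refine integral_congr_ae (.of_forall fun t => ?_)
    simp only [neg_zero, fourier_zero, one_smul]
    exact Complex.ext (by simp) (by simp [(hx t).1])
  -- The coefficient `x 0` is the mean of a positive function, so the term with `B` in the
  -- integrated inequality can be dropped.
  have hx0re : 0 ≤ (x 0 ^ (s : ℂ)).re := by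
    rw [hint, ← Complex.ofReal_cpow (integral_nonneg fun t => (hx t).2.le), Complex.ofReal_re]
    exact Real.rpow_nonneg (integral_nonneg fun t => (hx t).2.le) _
  set F : C(Torus, ℂ) := q.toAddCircle with hF
  have hFt (t : Torus) : F t = q.eval (fourier 1 t) := by
    rw [hF]
    simp [Polynomial.toAddCircle, Polynomial.aeval_def, Polynomial.eval₂_eq_sum,
      Polynomial.eval_eq_sum, Polynomial.sum_def, fourier_apply]
  have hcont : Continuous fun t : Torus => (q.eval (fourier 1 t)) ^ (s : ℂ) := by
    refine Continuous.cpow (by fun_prop) continuous_const fun t => Or.inl ?_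
    rw [hre]
    exact (hx t).2
  have hnorm_re (t : Torus) : ‖trigPoly x t‖ = (trigPoly x t).re := by
    have : trigPoly x t = ((trigPoly x t).re : ℂ) := Complex.ext (by simp) (by simp [(hx t).1])
    rw [this, Complex.norm_real, Complex.ofReal_re, Real.norm_of_nonneg (hx t).2.le]
  have hFnorm : ‖ContinuousMap.toLp (E := ℂ) p arc ℂ F‖ ^ s ≤ A * ‖trigLp p x‖ ^ s := by
    have e2 : ‖trigLp p x‖ ^ s = ∫ t, ‖trigPoly x t‖ ^ s ∂arc := norm_toLp_rpow p hp _
    rw [norm_toLp_rpow p hp, e2]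
    have hi1 : Integrable (fun t => ‖trigPoly x t‖ ^ s) arc :=
      integrable_continuousMap (by fun_prop (disch := positivity))
    have hi2 : Integrable (fun t : Torus => (q.eval (fourier 1 t)) ^ (s : ℂ)) arc :=
      integrable_continuousMap hcont
    have hi3 : Integrable (fun t => ‖F t‖ ^ s) arc :=
      integrable_continuousMap (by fun_prop (disch := positivity))
    calc ∫ t, ‖F t‖ ^ s ∂arc
        ≤ ∫ t, A * ‖trigPoly x t‖ ^ s - B * ((q.eval (fourier 1 t)) ^ (s : ℂ)).re ∂arc := by
          refine integral_mono hi3 ((hi1.const_mul A).sub (hi2.re.const_mul B)) fun t => ?_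
          have h3 := hAB (q.eval (fourier 1 t)) (by rw [hre]; exact (hx t).2)
          simp only [hFt]
          rwa [hnorm_re, ← hre]
      _ = A * ∫ t, ‖trigPoly x t‖ ^ s ∂arc - B * (x 0 ^ (s : ℂ)).re := by
          have h3 : ∫ t, ((q.eval (fourier 1 t)) ^ (s : ℂ)).re ∂arc = (x 0 ^ (s : ℂ)).re := by
            rw [← hmean]
            exact integral_re hi2
          rw [← h3, ← integral_const_mul, ← integral_const_mul]
          exact integral_sub (hi1.const_mul A) (hi2.re.const_mul B)
      _ ≤ _ := sub_le_self _ (by positivity)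
  have hFnorm' : ‖ContinuousMap.toLp (E := ℂ) p arc ℂ F‖ ≤ A ^ s⁻¹ * ‖trigLp p x‖ := by
    refine (Real.rpow_le_rpow_iff (norm_nonneg _) (by positivity) hs0).1 (hFnorm.trans_eq ?_)
    rw [Real.mul_rpow (by positivity) (by positivity), Real.rpow_inv_rpow hA hs0.ne']
  have hx0' : ‖x 0‖ ≤ ‖trigLp p x‖ := by
    have h3 := norm_integral_le_norm_toLp p (trigPoly x)
    rw [← fourierCoeff_trigPoly, fourierCoeff]
    simp only [neg_zero, fourier_zero, one_smul]
    exact h3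
  have hP : trigPoly (posPart x) = (2⁻¹ : ℂ) • (F + ContinuousMap.const _ (x 0)) := by
    ext t
    simp only [ContinuousMap.smul_apply, ContinuousMap.add_apply, ContinuousMap.const_apply, hFt,
      hq1, smul_eq_mul]
    ring
  calc ‖trigLp p (posPart x)‖
      = ‖(2⁻¹ : ℂ)‖ * ‖ContinuousMap.toLp (E := ℂ) p arc ℂ F +
          ContinuousMap.toLp (E := ℂ) p arc ℂ (ContinuousMap.const _ (x 0))‖ := by
        rw [← norm_smul, ← map_add, ← map_smul, ← hP]
        rfl
    _ ≤ 1 * (A ^ s⁻¹ * ‖trigLp p x‖ + ‖trigLp p x‖) := by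
        gcongr
        · norm_num
        · exact (norm_add_le _ _).trans
            (add_le_add hFnorm' ((norm_toLp_const p _).trans hx0'))
    _ = _ := by ring

/-- A real trigonometric polynomial `x` is a difference `v - (v - x)` of two positive ones, where
`v` approximates the positive part of `x`. -/
lemma norm_posPart_le_of_real (h1 : 1 < p) (h2 : p ≤ 2) :
    ∃ C : ℝ, 0 ≤ C ∧ ∀ x : ℤ →₀ ℂ, (∀ t, (trigPoly x t).im = 0) →
      ‖trigLp p (posPart x)‖ ≤ C * ‖trigLp p x‖ := by
  obtain ⟨C, hC, hpos⟩ := norm_posPart_le_of_pos p h1 h2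
  refine ⟨2 * C, by positivity, fun x hx => ?_⟩
  have key (ε : ℝ) (hε : 0 < ε) : ‖trigLp p (posPart x)‖ ≤ 2 * C * ‖trigLp p x‖ + 4 * C * ε := by
    -- The shift by `ε` keeps both `v` and `v - x` strictly positive after a uniform approximation
    -- within `ε`.
    let φ : C(Torus, ℂ) := ⟨fun t => ((max (trigPoly x t).re 0 + ε : ℝ) : ℂ), by fun_prop⟩
    obtain ⟨y, hy⟩ := denseRange_trigPoly.exists_dist_lt φ hε
    set v : ℤ →₀ ℂ := (2⁻¹ : ℂ) • (y + conjCoeff y) with hv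
    have hvt (t : Torus) : trigPoly v t = ((trigPoly y t).re : ℂ) := by
      rw [hv, map_smul, map_add, trigPoly_conjCoeff]
      simp only [ContinuousMap.smul_apply, ContinuousMap.add_apply, ContinuousMap.star_apply,
        Complex.star_def, Complex.add_conj, smul_eq_mul]
      push_cast
      ring
    have hdist (t : Torus) : |max (trigPoly x t).re 0 + ε - (trigPoly y t).re| < ε := by
      have h3 := (ContinuousMap.dist_apply_le_dist t).trans_lt hy
      rw [dist_eq_norm] at h3
      have h4 := (Complex.abs_re_le_norm _).trans_lt h3
      simpa [φ] using h4
    have hxt (t : Torus) : trigPoly x t = ((trigPoly x t).re : ℂ) :=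
      Complex.ext (by simp) (by simp [hx t])
    have hnx (t : Torus) : ‖trigPoly x t‖ = |(trigPoly x t).re| := by
      rw [hxt, Complex.norm_real, Complex.ofReal_re, Real.norm_eq_abs]
    have hsub (t : Torus) : trigPoly (v - x) t = (((trigPoly y t).re - (trigPoly x t).re : ℝ) : ℂ) := by
      rw [map_sub, ContinuousMap.sub_apply, hvt, Complex.ofReal_sub, ← hxt]
    have b1 : ‖trigLp p v‖ ≤ ‖trigLp p x‖ + 2 * ε := by
      refine norm_toLp_le_add p (by positivity) fun t => ?_
      rw [hnx, hvt, Complex.norm_real, Real.norm_eq_abs]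
      have := abs_lt.1 (hdist t)
      rw [abs_le]
      rcases max_cases (trigPoly x t).re 0 with h | h <;> rcases abs_cases (trigPoly x t).re with h' | h' <;>
        constructor <;> linarith
    have b2 : ‖trigLp p (v - x)‖ ≤ ‖trigLp p x‖ + 2 * ε := by
      refine norm_toLp_le_add p (by positivity) fun t => ?_
      rw [hnx, hsub, Complex.norm_real, Real.norm_eq_abs]
      have := abs_lt.1 (hdist t)
      rw [abs_le]
      rcases max_cases (trigPoly x t).re 0 with h | h <;> rcases abs_cases (trigPoly x t).re with h' | h' <;>
        constructor <;> linarith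
    have c1 := hpos v fun t => by
      rw [hvt]
      have := abs_lt.1 (hdist t)
      have := le_max_right (trigPoly x t).re 0
      exact ⟨Complex.ofReal_im _, by rw [Complex.ofReal_re]; linarith⟩
    have c2 := hpos (v - x) fun t => by
      rw [hsub]
      have := abs_lt.1 (hdist t)
      have := le_max_left (trigPoly x t).re 0
      exact ⟨Complex.ofReal_im _, by rw [Complex.ofReal_re]; linarith⟩
    calc ‖trigLp p (posPart x)‖ = ‖trigLp p (posPart v) - trigLp p (posPart (v - x))‖ := by
          rw [← map_sub, ← map_sub, sub_sub_cancel]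
      _ ≤ C * (‖trigLp p x‖ + 2 * ε) + C * (‖trigLp p x‖ + 2 * ε) := by
          refine (norm_sub_le _ _).trans (add_le_add (c1.trans ?_) (c2.trans ?_)) <;> gcongr
      _ = _ := by ring
  refine le_of_forall_pos_le_add fun δ hδ => (key (δ / (4 * C + 1)) (by positivity)).trans ?_
  gcongr
  rw [mul_div_assoc', div_le_iff₀ (by positivity)]
  nlinarith

lemma norm_posPart_le_of_le_two (h1 : 1 < p) (h2 : p ≤ 2) :
    ∃ C : ℝ, 0 ≤ C ∧ ∀ x : ℤ →₀ ℂ, ‖trigLp p (posPart x)‖ ≤ C * ‖trigLp p x‖ := by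
  obtain ⟨C, hC, hreal⟩ := norm_posPart_le_of_real p h1 h2
  refine ⟨2 * C, by positivity, fun x => ?_⟩
  set u : ℤ →₀ ℂ := (2⁻¹ : ℂ) • (x + conjCoeff x) with hu
  set w : ℤ →₀ ℂ := (-Complex.I) • (x - u) with hw
  have hut (t : Torus) : trigPoly u t = ((trigPoly x t).re : ℂ) := by
    rw [hu, map_smul, map_add, trigPoly_conjCoeff]
    simp only [ContinuousMap.smul_apply, ContinuousMap.add_apply, ContinuousMap.star_apply,
      Complex.star_def, Complex.add_conj, smul_eq_mul]
    push_cast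
    ring
  have hwt (t : Torus) : trigPoly w t = ((trigPoly x t).im : ℂ) := by
    rw [hw, map_smul, map_sub, ContinuousMap.smul_apply, ContinuousMap.sub_apply, hut]
    apply Complex.ext <;> simp
  have hx : x = u + Complex.I • w := by
    rw [hw, smul_smul]
    simp
  have b1 : ‖trigLp p u‖ ≤ ‖trigLp p x‖ := norm_toLp_mono p fun t => by
    rw [hut, Complex.norm_real]
    exact Complex.abs_re_le_norm _
  have b2 : ‖trigLp p w‖ ≤ ‖trigLp p x‖ := norm_toLp_mono p fun t => by
    rw [hwt, Complex.norm_real]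
    exact Complex.abs_im_le_norm _
  have c1 := hreal u fun t => by rw [hut, Complex.ofReal_im]
  have c2 := hreal w fun t => by rw [hwt, Complex.ofReal_im]
  clear_value w u
  calc ‖trigLp p (posPart x)‖ = ‖trigLp p (posPart u) + Complex.I • trigLp p (posPart w)‖ := by
        conv_lhs => rw [hx]
        rw [map_add, map_add, map_smul, map_smul]
    _ ≤ C * ‖trigLp p x‖ + C * ‖trigLp p x‖ := by
        refine (norm_add_le _ _).trans (add_le_add (c1.trans ?_) ?_)
        · gcongr
        · rw [norm_smul, Complex.norm_I, one_mul]
          exact c2.trans (by gcongr)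
    _ = _ := by ring

/-- Hölder's inequality for continuous functions. -/
lemma norm_integral_mul_conj_le (p q : ℝ≥0∞) [Fact (1 ≤ p)] [Fact (1 ≤ q)] (hp : p ≠ ∞)
    (hq : q ≠ ∞) (hpq : p.toReal.HolderConjugate q.toReal) (φ ψ : C(Torus, ℂ)) :
    ‖∫ t, φ t * starRingEnd ℂ (ψ t) ∂arc‖ ≤
      ‖ContinuousMap.toLp (E := ℂ) p arc ℂ φ‖ * ‖ContinuousMap.toLp (E := ℂ) q arc ℂ ψ‖ := by
  have h := integral_mul_norm_le_Lp_mul_Lq (μ := arc) hpq (memLp_continuousMap _ φ)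
    (memLp_continuousMap _ ψ)
  rw [← norm_toLp_rpow p hp, ← norm_toLp_rpow q hq, one_div, one_div,
    Real.rpow_rpow_inv (norm_nonneg _) hpq.ne_zero,
    Real.rpow_rpow_inv (norm_nonneg _) hpq.symm.ne_zero] at h
  refine (norm_integral_le_integral_norm _).trans (le_of_eq_of_le ?_ h)
  simp

/-- Duality: the projection is symmetric for the `L²` pairing, so its bound on `L^q` passes to
`L^p`. -/
lemma norm_posPart_le_of_conjugate (p q : ℝ≥0∞) [Fact (1 ≤ p)] [Fact (1 ≤ q)] (hp : p ≠ ∞)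
    (hq : q ≠ ∞) (hpq : p.toReal.HolderConjugate q.toReal) (hp2 : 2 ≤ p.toReal) {C : ℝ} (hC : 0 ≤ C)
    (h : ∀ x : ℤ →₀ ℂ, ‖trigLp q (posPart x)‖ ≤ C * ‖trigLp q x‖) (x : ℤ →₀ ℂ) :
    ‖trigLp p (posPart x)‖ ≤ C * ‖trigLp p x‖ := by
  set s := p.toReal with hs
  set φ := trigPoly (posPart x) with hφ
  have hs1 : 0 < s - 1 := hpq.sub_one_pos
  -- This is the norming function of `φ`: both `φ * conj g` and `|g|^q` equal `|φ|^p`. The condition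
  -- `2 ≤ p` makes it continuous where `φ` vanishes.
  let g : C(Torus, ℂ) := ⟨fun t => ((‖φ t‖ ^ (s - 2) : ℝ) : ℂ) * φ t, by
    have : Continuous fun t => ‖φ t‖ ^ (s - 2) :=
      Continuous.rpow_const (by fun_prop) fun t => Or.inr (by linarith)
    fun_prop⟩
  have hg (t : Torus) : ‖g t‖ = ‖φ t‖ ^ (s - 1) := by
    change ‖((‖φ t‖ ^ (s - 2) : ℝ) : ℂ) * φ t‖ = _
    rw [norm_mul, Complex.norm_real, Real.norm_of_nonneg (by positivity),
      ← Real.rpow_add_one' (norm_nonneg _) (by linarith)]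
    congr 1
    ring
  have hφg (t : Torus) : φ t * starRingEnd ℂ (g t) = ((‖φ t‖ ^ s : ℝ) : ℂ) := by
    change φ t * starRingEnd ℂ (((‖φ t‖ ^ (s - 2) : ℝ) : ℂ) * φ t) = _
    rw [map_mul, Complex.conj_ofReal, mul_left_comm, Complex.mul_conj, Complex.normSq_eq_norm_sq,
      ← Complex.ofReal_mul, ← Real.rpow_natCast,
      ← Real.rpow_add' (norm_nonneg _) (by push_cast; linarith)]
    congr 2
    push_cast
    ring
  set I : ℝ := ∫ t, ‖φ t‖ ^ s ∂arc with hI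
  have hIp : ‖trigLp p (posPart x)‖ ^ s = I := norm_toLp_rpow p hp _
  have hIq : ‖ContinuousMap.toLp (E := ℂ) q arc ℂ g‖ ^ q.toReal = I := by
    rw [norm_toLp_rpow q hq]
    simp only [hg]
    refine integral_congr_ae (.of_forall fun t => ?_)
    simp only [← Real.rpow_mul (norm_nonneg _), hpq.sub_one_mul_conj]
  -- As `g` need not be a trigonometric polynomial, symmetry is applied to an approximant `y`, and
  -- the error goes into the term with `ε`.
  have key (ε : ℝ) (hε : 0 < ε) : I ≤ C * ‖trigLp p x‖ * ‖ContinuousMap.toLp (E := ℂ) q arc ℂ g‖ +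
      (C * ‖trigLp p x‖ + ‖trigLp p (posPart x)‖) * ε := by
    obtain ⟨y, hy⟩ := denseRange_trigPoly.exists_dist_lt g hε
    have hgy (t : Torus) : ‖g t - trigPoly y t‖ ≤ ε := by
      rw [← dist_eq_norm]
      exact ((ContinuousMap.dist_apply_le_dist t).trans_lt hy).le
    have e1 : ‖trigLp q y‖ ≤ ‖ContinuousMap.toLp (E := ℂ) q arc ℂ g‖ + ε :=
      norm_toLp_le_add q hε.le fun t => by
        have h3 := norm_sub_le (g t) (g t - trigPoly y t)
        rw [sub_sub_cancel] at h3
        exact h3.trans (add_le_add le_rfl (hgy t))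
    have e2 : ‖ContinuousMap.toLp (E := ℂ) q arc ℂ (g - trigPoly y)‖ ≤ ε := by
      have h3 := norm_toLp_le_add q (φ := g - trigPoly y) (ψ := 0) hε.le fun t => by
        simpa using hgy t
      simpa using h3
    have hi (u v : C(Torus, ℂ)) : Integrable (fun t => u t * starRingEnd ℂ (v t)) arc :=
      integrable_continuousMap (by fun_prop)
    have e3 : ((I : ℝ) : ℂ) = ∫ t, φ t * starRingEnd ℂ ((g - trigPoly y) t) ∂arc +
        ∫ t, trigPoly x t * starRingEnd ℂ (trigPoly (posPart y) t) ∂arc := by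
      rw [← integral_posPart_mul_conj, ← integral_add (hi _ _) (hi _ _), hI,
        ← integral_complex_ofReal]
      refine integral_congr_ae (.of_forall fun t => ?_)
      simp only [← hφg, ContinuousMap.sub_apply, map_sub]
      ring
    have hI0 : 0 ≤ I := integral_nonneg fun t => by positivity
    calc I = ‖((I : ℝ) : ℂ)‖ := by rw [Complex.norm_real, Real.norm_of_nonneg hI0]
      _ ≤ ‖trigLp p (posPart x)‖ * ε + ‖trigLp p x‖ *
          (C * (‖ContinuousMap.toLp (E := ℂ) q arc ℂ g‖ + ε)) := by
          rw [e3]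
          refine (norm_add_le _ _).trans (add_le_add ?_ ?_)
          · exact (norm_integral_mul_conj_le p q hp hq hpq _ _).trans
              (mul_le_mul_of_nonneg_left e2 (norm_nonneg _))
          · exact (norm_integral_mul_conj_le p q hp hq hpq _ _).trans
              (mul_le_mul_of_nonneg_left ((h y).trans (by gcongr)) (norm_nonneg _))
      _ = _ := by ring
  have hle : I ≤ C * ‖trigLp p x‖ * ‖ContinuousMap.toLp (E := ℂ) q arc ℂ g‖ := by
    set K := C * ‖trigLp p x‖ + ‖trigLp p (posPart x)‖ with hK
    have hK0 : 0 ≤ K := by positivity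
    refine le_of_forall_pos_le_add fun δ hδ => (key (δ / (K + 1)) (by positivity)).trans ?_
    gcongr
    rw [mul_div_assoc', div_le_iff₀ (by positivity)]
    nlinarith
  rcases (norm_nonneg (trigLp p (posPart x))).eq_or_lt with h0 | h0
  · rw [← h0]; positivity
  · have h3 : ‖ContinuousMap.toLp (E := ℂ) q arc ℂ g‖ = ‖trigLp p (posPart x)‖ ^ (s - 1) := by
      rw [← Real.rpow_left_inj (norm_nonneg _) (by positivity) hpq.symm.ne_zero, hIq,
        ← Real.rpow_mul (norm_nonneg _), hpq.sub_one_mul_conj, hIp]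
    have h4 : I = ‖trigLp p (posPart x)‖ * ‖trigLp p (posPart x)‖ ^ (s - 1) := by
      rw [← hIp, ← Real.rpow_one_add' (norm_nonneg _) (by linarith)]
      congr 1
      ring
    rw [h3, h4] at hle
    exact le_of_mul_le_mul_right hle (Real.rpow_pos_of_pos h0 _)

/-- **M. Riesz**: the analytic projection of trigonometric polynomials is bounded in `L^p`. -/
theorem norm_posPart_le (h1 : 1 < p) (hp : p ≠ ∞) :
    ∃ C : ℝ, ∀ x : ℤ →₀ ℂ, ‖trigLp p (posPart x)‖ ≤ C * ‖trigLp p x‖ := by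
  rcases le_total p 2 with h2 | h2
  · obtain ⟨C, -, hC⟩ := norm_posPart_le_of_le_two p h1 h2
    exact ⟨C, hC⟩
  · have hs2 : 2 ≤ p.toReal := by simpa using (ENNReal.toReal_le_toReal (by simp) hp).2 h2
    have hpq := Real.HolderConjugate.conjExponent (p := p.toReal) (by linarith)
    set r := Real.conjExponent p.toReal with hr
    have hr1 : 1 < r := hpq.symm.lt
    have hr2 : r ≤ 2 := by
      rw [hr, Real.conjExponent, div_le_iff₀ (by linarith)]
      linarith
    have hq : (ENNReal.ofReal r).toReal = r := ENNReal.toReal_ofReal (by linarith)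
    have hq1 : 1 < ENNReal.ofReal r := by simpa using hr1
    have hq2 : ENNReal.ofReal r ≤ 2 := by simpa using ENNReal.ofReal_le_ofReal hr2
    have : Fact (1 ≤ ENNReal.ofReal r) := ⟨hq1.le⟩
    obtain ⟨C, hC, hCq⟩ := norm_posPart_le_of_le_two (ENNReal.ofReal r) hq1 hq2
    exact ⟨C, norm_posPart_le_of_conjugate p _ hp ENNReal.ofReal_ne_top (by rwa [hq]) hs2 hC hCq⟩

/-- The Riesz projection on `L^p`, `1 < p < ∞`. -/
theorem exists_rieszProjection (h1 : 1 < p) (hp : p ≠ ∞) :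
    ∃ P : LpT p →L[ℂ] Hardy p, ∀ (f : LpT p) (n : ℤ), 0 ≤ n →
      fourierCoeff (P f : LpT p) n = fourierCoeff f n := by
  set P₀ : LpT p →L[ℂ] LpT p := (trigLp p ∘ₗ posPart).extendOfNorm (trigLp p) with hP₀
  have hcoeff (f : LpT p) (n : ℤ) :
      coeffL p n (P₀ f) = if 0 ≤ n then coeffL p n f else 0 := by
    refine (denseRange_trigLp p hp).induction_on f (isClosed_eq (by fun_prop) ?_) fun x => ?_
    · split_ifs <;> fun_prop
    · rw [hP₀, LinearMap.extendOfNorm_eq (denseRange_trigLp p hp) (norm_posPart_le p h1 hp)]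
      simp [fourierCoeff_trigLp, posPart_apply]
  refine ⟨P₀.codRestrict (Hardy p) fun f n hn => ?_, fun f n hn => ?_⟩
  · rw [← coeffL_apply, hcoeff, if_neg (by omega)]
  · change coeffL p n (P₀ f) = _
    rw [hcoeff, if_pos hn, coeffL_apply]

lemma fourierCoeff_rieszP (h1 : 1 < p) (hp : p ≠ ∞) (f : LpT p) (n : ℤ) :
    fourierCoeff (rieszP p f : LpT p) n = if 0 ≤ n then fourierCoeff f n else 0 := by
  split_ifs with hn
  · rw [rieszP, dif_pos (exists_rieszProjection p h1 hp)]
    exact (exists_rieszProjection p h1 hp).choose_spec f n hn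
  · exact (rieszP p f).2 n (by omega)

end Riesz

/-! ### Multiples of an almost everywhere nonvanishing function -/

section Density

variable (p : ℝ≥0∞) [Fact (1 ≤ p)]

/-- Multiplication by `w` carries the weighted norm for the finite measure `|w|^p` to the usual one,
which reduces density of multiples of `w` to density of continuous functions. -/
lemma eLpNorm_withDensity (hp : p ≠ ∞) (w : LpT p) {g : Torus → ℂ}
    (hg : AEStronglyMeasurable g arc) :
    eLpNorm g p (arc.withDensity fun t => ‖w t‖ₑ ^ p.toReal) = eLpNorm (fun t => g t * w t) p arc := by
  have h0 : p ≠ 0 := (zero_lt_one.trans_le Fact.out).ne'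
  have hw : AEMeasurable (fun t => ‖w t‖ₑ ^ p.toReal) arc :=
    (Lp.aestronglyMeasurable w).enorm.pow_const _
  rw [eLpNorm_eq_lintegral_rpow_enorm_toReal h0 hp, eLpNorm_eq_lintegral_rpow_enorm_toReal h0 hp,
    lintegral_withDensity_eq_lintegral_mul₀ hw (hg.enorm.pow_const _)]
  congr 1
  refine lintegral_congr fun t => ?_
  rw [Pi.mul_apply, enorm_mul, ENNReal.mul_rpow_of_nonneg _ _ ENNReal.toReal_nonneg, mul_comm]

lemma isFiniteMeasure_withDensity_rpow (hp : p ≠ ∞) (w : LpT p) :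
    IsFiniteMeasure (arc.withDensity fun t => ‖w t‖ₑ ^ p.toReal) :=
  isFiniteMeasure_withDensity (lintegral_rpow_enorm_lt_top_of_eLpNorm_lt_top
    (zero_lt_one.trans_le Fact.out).ne' hp (Lp.eLpNorm_lt_top w)).ne

/-- If `w` vanishes almost nowhere, its multiples by continuous functions are dense in `L^p`. -/
lemma denseRange_mulC (hp : p ≠ ∞) (w : LpT p) (hw : ∀ᵐ t ∂arc, w t ≠ 0) :
    DenseRange fun φ : C(Torus, ℂ) => mulC p φ w := by
  have := isFiniteMeasure_withDensity_rpow p hp w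
  refine Metric.denseRange_iff.2 fun u ε hε => ?_
  have hgm : AEStronglyMeasurable (fun t => u t / w t) arc :=
    ((Lp.aestronglyMeasurable u).aemeasurable.div
      (Lp.aestronglyMeasurable w).aemeasurable).aestronglyMeasurable
  have hg : MemLp (fun t => u t / w t) p (arc.withDensity fun t => ‖w t‖ₑ ^ p.toReal) := by
    refine ⟨hgm.mono_ac (withDensity_absolutelyContinuous _ _), ?_⟩
    rw [eLpNorm_withDensity p hp w hgm]
    refine lt_of_eq_of_lt (eLpNorm_congr_ae ?_) (Lp.eLpNorm_lt_top u)
    filter_upwards [hw] with t ht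
    exact div_mul_cancel₀ _ ht
  obtain ⟨φ, hφ, -⟩ := hg.exists_boundedContinuous_eLpNorm_sub_le hp
    (ε := ENNReal.ofReal (ε / 2)) (by simpa using hε)
  refine ⟨φ.toContinuousMap, ?_⟩
  rw [dist_eq_norm, Lp.norm_def]
  refine lt_of_le_of_lt (ENNReal.toReal_le_of_le_ofReal (by positivity) ?_) (half_lt_self hε)
  refine le_of_eq_of_le ?_ hφ
  rw [eLpNorm_withDensity p hp w (hgm.sub φ.continuous.aestronglyMeasurable)]
  refine eLpNorm_congr_ae ?_
  filter_upwards [Lp.coeFn_sub u (mulC p φ.toContinuousMap w), coeFn_mulC p φ.toContinuousMap w, hw]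
    with t h1 h2 h3
  rw [h1, Pi.sub_apply, h2, Pi.sub_apply, sub_mul, div_mul_cancel₀ _ h3]
  rfl

lemma denseRange_mulC_trigPoly (hp : p ≠ ∞) (w : LpT p) (hw : ∀ᵐ t ∂arc, w t ≠ 0) :
    DenseRange fun x : ℤ →₀ ℂ => mulC p (trigPoly x) w :=
  (denseRange_mulC p hp w hw).comp denseRange_trigPoly ((mulC p).flip w).continuous

end Density

/-! ### Functions in `H^p` vanish almost nowhere -/

section Nonvanishing

variable (p : ℝ≥0∞) [Fact (1 ≤ p)]

instance nontrivial_torus : Nontrivial Torus := by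
  by_contra h
  rw [not_nontrivial_iff_subsingleton] at h
  have h1 : trigPoly (Finsupp.single 1 1) = trigPoly (Finsupp.single 0 1) := by
    ext t
    simp [trigPoly_single, Subsingleton.elim t 0]
  simpa using DFunLike.congr_fun (trigPoly_injective h1) 1

lemma ae_eval_ne_zero {q : Polynomial ℂ} (hq : q ≠ 0) :
    ∀ᵐ t ∂arc, q.eval (fourier 1 t) ≠ 0 := by
  have hfin : {t : Torus | q.eval (fourier 1 t) = 0}.Finite := by
    have h : {z : ℂ | q.eval z = 0}.Finite := by
      simpa [Polynomial.IsRoot] using q.finite_setOfPred_isRoot hq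
    refine h.preimage (Function.Injective.injOn fun t t' ht => ?_)
    refine AddCircle.injective_toCircle (T := 2 * π) (by positivity) (Subtype.ext ?_)
    simpa [fourier_apply] using ht
  have := hfin.measure_zero arc
  rw [ae_iff]
  simpa using this

lemma integrable_log_norm_eval (q : Polynomial ℂ) :
    Integrable (fun t : Torus => Real.log ‖q.eval (fourier 1 t)‖) arc := by
  have hm : Measurable fun t : Torus => Real.log ‖q.eval (fourier 1 t)‖ :=
    Real.measurable_log.comp (Continuous.measurable (by fun_prop))
  have h := (AddCircle.measurePreserving_mk (2 * π) 0).integrable_comp (g := fun t : Torus =>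
    Real.log ‖q.eval (fourier 1 t)‖) hm.aestronglyMeasurable
  have h2 := q.intervalIntegrable_mahlerMeasure
  rw [intervalIntegrable_iff_integrableOn_Ioc_of_le (by positivity)] at h2
  have h3 : Integrable (fun t : Torus => Real.log ‖q.eval (fourier 1 t)‖) volume := by
    rw [← h, zero_add]
    refine h2.congr (.of_forall fun x => ?_)
    simp [AddCircle.toCircle, circleMap]
  rw [AddCircle.volume_eq_smul_haarAddCircle] at h3
  exact (integrable_smul_measure (by simp [Real.pi_pos]) ENNReal.ofReal_ne_top).1 h3

/-- This is Jensen's inequality, read off from the bound of coefficients by the Mahler measure. -/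
lemma norm_coeff_zero_le_exp {q : Polynomial ℂ} (hq : q ≠ 0) :
    ‖q.coeff 0‖ ≤ Real.exp (∫ t, Real.log ‖q.eval (fourier 1 t)‖ ∂arc) := by
  have h := q.norm_coeff_le_choose_mul_mahlerMeasure 0
  rw [Nat.choose_zero_right, Nat.cast_one, one_mul, Polynomial.mahlerMeasure, if_pos hq,
    Polynomial.logMahlerMeasure, circleAverage_eq_integral fun z => Real.log ‖q.eval z‖] at h
  exact h

/-- The weight equal to `M` on `E` and to `1` elsewhere. -/
def weight (E : Set Torus) (M : ℝ) (t : Torus) : ℝ := Real.exp (E.indicator (fun _ => Real.log M) t)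

lemma weight_nonneg (E : Set Torus) (M : ℝ) (t : Torus) : 0 ≤ weight E M t := Real.exp_nonneg _

lemma weight_le {E : Set Torus} {M : ℝ} (hM : 1 ≤ M) (t : Torus) : weight E M t ≤ M := by
  rw [weight, ← Real.le_log_iff_exp_le (by positivity)]
  exact Set.indicator_le_self' (fun _ _ => Real.log_nonneg hM) t

lemma measurable_weight {E : Set Torus} (hE : MeasurableSet E) (M : ℝ) :
    Measurable (weight E M) :=
  Real.measurable_exp.comp (measurable_const.indicator hE)

/-- A weighted form of Jensen's inequality `log |q(0)| ≤ ∫ log |q|`. -/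
lemma norm_coeff_zero_mul_rpow_le (q : Polynomial ℂ) {E : Set Torus} (hE : MeasurableSet E)
    {M : ℝ} (hM : 1 ≤ M) :
    ‖q.coeff 0‖ * M ^ arc.real E ≤ ∫ t, ‖q.eval (fourier 1 t)‖ * weight E M t ∂arc := by
  have hM0 : 0 < M := by positivity
  rcases eq_or_ne q 0 with rfl | hq
  · simp
  set ℓ : Torus → ℝ := fun t => Real.log ‖q.eval (fourier 1 t)‖ with hℓ
  set k : Torus → ℝ := E.indicator fun _ => Real.log M with hk
  have hki : Integrable k arc := (integrable_const _).indicator hE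
  have hℓi : Integrable ℓ arc := integrable_log_norm_eval q
  have hexp : (fun t => Real.exp (ℓ t + k t)) =ᵐ[arc]
      fun t => ‖q.eval (fourier 1 t)‖ * weight E M t := by
    filter_upwards [ae_eval_ne_zero hq] with t ht
    rw [Real.exp_add, hℓ, Real.exp_log (norm_pos_iff.2 ht), weight]
  have hwi : Integrable (fun t => ‖q.eval (fourier 1 t)‖ * weight E M t) arc := by
    refine Integrable.mul_bdd (c := M) (integrable_continuousMap (by fun_prop))
      (measurable_weight hE M).aestronglyMeasurable (.of_forall fun t => ?_)
    rw [Real.norm_of_nonneg (weight_nonneg _ _ _)]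
    exact weight_le hM t
  -- Convexity of `exp` applied to `log |q| + log weight`; the integral of the second summand
  -- produces the factor `M ^ arc.real E`.
  have hjensen := convexOn_exp.map_integral_le (μ := arc) (f := fun t => ℓ t + k t)
    Real.continuous_exp.continuousOn isClosed_univ (by simp) (hℓi.add hki) (hwi.congr hexp.symm)
  rw [integral_congr_ae hexp, integral_add hℓi hki, Real.exp_add] at hjensen
  refine le_trans ?_ hjensen
  have hkint : Real.exp (∫ t, k t ∂arc) = M ^ arc.real E := by
    rw [hk, integral_indicator hE, setIntegral_const, smul_eq_mul, Real.rpow_def_of_pos hM0,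
      mul_comm]
  rw [hkint]
  exact mul_le_mul_of_nonneg_right (norm_coeff_zero_le_exp hq) (by positivity)

/-- Both sides are continuous in `f`. Stating the bound for `P f` with `f` in all of `L^p` allows a
check on trigonometric polynomials, whose projections are analytic polynomials. -/
lemma norm_fourierCoeff_zero_mul_rpow_le (h1 : 1 < p) (hp : p ≠ ∞) {E : Set Torus}
    (hE : MeasurableSet E) {M : ℝ} (hM : 1 ≤ M) (b : LInf)
    (hb : ∀ᵐ t ∂arc, b t = weight E M t) (f : LpT p) :
    ‖fourierCoeff f 0‖ * M ^ arc.real E ≤ ‖mulOp p b (rieszP p f : LpT p)‖ := by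
  rw [← coeffL_apply]
  refine (denseRange_trigLp p hp).induction_on f (isClosed_le ?_ ?_) fun x => ?_
  · exact ((coeffL p 0).continuous.norm).mul_const _
  · exact ((mulOp p b).continuous.comp
      (continuous_subtype_val.comp (rieszP p).continuous)).norm
  · have hP : (rieszP p (trigLp p x) : LpT p) = trigLp p (posPart x) :=
      ext_fourierCoeff p fun n => by
        rw [fourierCoeff_rieszP p h1 hp, fourierCoeff_trigLp, fourierCoeff_trigLp, posPart_apply]
    have hval : (mulOp p b (trigLp p (posPart x)) : Torus → ℂ) =ᵐ[arc]
        fun t => weight E M t * (toPoly x).eval (fourier 1 t) := by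
      filter_upwards [coeFn_mulOp p b (trigLp p (posPart x)), coeFn_trigLp p (posPart x), hb]
        with t h2 h3 h4
      rw [h2, h3, h4, eval_toPoly]
    have hint : ∫ t, ‖(toPoly x).eval (fourier 1 t)‖ * weight E M t ∂arc =
        ∫ t, ‖mulOp p b (trigLp p (posPart x)) t‖ ∂arc := by
      refine integral_congr_ae ?_
      filter_upwards [hval] with t ht
      rw [ht, norm_mul, Complex.norm_real, Real.norm_of_nonneg (weight_nonneg _ _ _), mul_comm]
    rw [hP, coeffL_apply, fourierCoeff_trigLp, ← coeff_zero_toPoly]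
    refine (norm_coeff_zero_mul_rpow_le _ hE hM).trans (hint.trans_le ?_)
    rw [Lp.norm_def, integral_norm_eq_lintegral_enorm (Lp.aestronglyMeasurable _)]
    refine ENNReal.toReal_mono (Lp.eLpNorm_ne_top _) ?_
    rw [← eLpNorm_one_eq_lintegral_enorm]
    exact eLpNorm_le_eLpNorm_of_exponent_le Fact.out (Lp.aestronglyMeasurable _)

lemma rieszP_coe (h1 : 1 < p) (hp : p ≠ ∞) (f : Hardy p) : rieszP p f = f := by
  refine Subtype.ext (ext_fourierCoeff p fun n => ?_)
  rw [fourierCoeff_rieszP p h1 hp]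
  split_ifs with hn
  · rfl
  · exact (f.2 n (by omega)).symm

/-- Put the weight `M` on the zero set of `f`: the weighted function is still `f`, yet the lower
bound for its norm would grow without limit as `M → ∞` if that set had positive measure. -/
lemma ae_ne_zero_of_fourierCoeff_zero (h1 : 1 < p) (hp : p ≠ ∞) (f : Hardy p)
    (hf : fourierCoeff (f : LpT p) 0 ≠ 0) : ∀ᵐ t ∂arc, (f : LpT p) t ≠ 0 := by
  set E : Set Torus := {t | (f : LpT p) t = 0} with hE
  have hEm : MeasurableSet E :=
    (Lp.stronglyMeasurable (f : LpT p)).measurable (measurableSet_singleton 0)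
  rw [ae_iff]
  simp only [not_not]
  by_contra hμ
  have hδ : 0 < arc.real E := ENNReal.toReal_pos hμ (measure_ne_top _ _)
  have key (M : ℝ) (hM : 1 ≤ M) :
      ‖fourierCoeff (f : LpT p) 0‖ * M ^ arc.real E ≤ ‖(f : LpT p)‖ := by
    have hb : MemLp (fun t => (weight E M t : ℂ)) ∞ arc :=
      memLp_top_of_bound (Complex.measurable_ofReal.comp
        (measurable_weight hEm M)).aestronglyMeasurable M (.of_forall fun t => by
          rw [Complex.norm_real, Real.norm_of_nonneg (weight_nonneg _ _ _)]
          exact weight_le hM t)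
    have h := norm_fourierCoeff_zero_mul_rpow_le p h1 hp hEm hM hb.toLp hb.coeFn_toLp f
    rw [rieszP_coe p h1 hp] at h
    refine h.trans_eq (congrArg norm (Lp.ext ?_))
    filter_upwards [coeFn_mulOp p hb.toLp (f : LpT p), hb.coeFn_toLp] with t h2 h3
    rw [h2, h3]
    by_cases ht : t ∈ E
    · rw [show (f : LpT p) t = 0 from ht, mul_zero]
    · simp [weight, ht]
  have hlim : Filter.Tendsto (fun M : ℝ => ‖fourierCoeff (f : LpT p) 0‖ * M ^ arc.real E)
      Filter.atTop Filter.atTop :=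
    (tendsto_rpow_atTop hδ).const_mul_atTop (norm_pos_iff.2 hf)
  obtain ⟨M, hM1, hM2⟩ := ((hlim.eventually_gt_atTop ‖(f : LpT p)‖).and
    (Filter.eventually_ge_atTop 1)).exists
  exact absurd (key M hM2) (not_le.2 hM1)

/-- A nonzero function in `H^p` vanishes almost nowhere. -/
theorem ae_ne_zero_of_hardy (h1 : 1 < p) (hp : p ≠ ∞) (f : Hardy p) (hf : f ≠ 0) :
    ∀ᵐ t ∂arc, (f : LpT p) t ≠ 0 := by
  have hex : ∃ n : ℕ, fourierCoeff (f : LpT p) n ≠ 0 := by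
    by_contra! h
    refine hf (Subtype.ext (eq_zero_of_fourierCoeff p _ fun n => ?_))
    rcases lt_or_ge n 0 with hn | hn
    · exact f.2 n hn
    · lift n to ℕ using hn
      exact h n
  classical
  have hmin (m : ℕ) (hm : m < Nat.find hex) : fourierCoeff (f : LpT p) m = 0 :=
    not_not.1 (Nat.find_min hex hm)
  set k := Nat.find hex
  -- Division by `t ^ k`, with `k` the first index of a nonzero coefficient, keeps `f` in `H^p` and
  -- makes the mean nonzero.
  let g : Hardy p := ⟨mulC p (fourier (-k)) f, fun n hn => by
    rw [fourierCoeff_mulC_fourier]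
    rcases lt_or_ge (n - -(k : ℤ)) 0 with h | h
    · exact f.2 _ h
    · obtain ⟨m, hm⟩ := Int.eq_ofNat_of_zero_le h
      rw [hm]
      exact hmin m (by omega)⟩
  have hg : fourierCoeff (g : LpT p) 0 ≠ 0 := by
    change fourierCoeff (mulC p (fourier (-k)) f) 0 ≠ 0
    rw [fourierCoeff_mulC_fourier, zero_sub, neg_neg]
    exact Nat.find_spec hex
  filter_upwards [ae_ne_zero_of_fourierCoeff_zero p h1 hp g hg, coeFn_mulC p (fourier (-k)) f]
    with t h2 h3 h4
  refine h2 ?_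
  change mulC p (fourier (-k)) f t = 0
  rw [h3, h4, mul_zero]

end Nonvanishing

/-! ### Coburn's lemma and one-sided invertibility of Fredholm Toeplitz operators -/

section Coburn

variable (p : ℝ≥0∞) [Fact (1 ≤ p)]

/-- **Coburn's lemma**: a Toeplitz operator with a nontrivial kernel has dense range. -/
theorem denseRange_toeplitz (h1 : 1 < p) (hp : p ≠ ∞) (c : LInf) (hc : ∀ᵐ t ∂arc, c t ≠ 0)
    (f : Hardy p) (hf : f ≠ 0) (hcf : toeplitz p c f = 0) : DenseRange (toeplitz p c) := by
  set w : LpT p := mulOp p c f with hw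
  have hw0 : ∀ᵐ t ∂arc, w t ≠ 0 := by
    filter_upwards [coeFn_mulOp p c (f : LpT p), hc, ae_ne_zero_of_hardy p h1 hp f hf]
      with t h2 h3 h4
    rw [hw, h2]
    exact mul_ne_zero h3 h4
  have hcoeff (n : ℤ) (hn : 0 ≤ n) : fourierCoeff w n = 0 := by
    have h2 := fourierCoeff_rieszP p h1 hp w n
    rw [if_pos hn, show rieszP p w = 0 from hcf] at h2
    rw [← h2]
    exact (coeffL p n).map_zero
  -- With `w = c f` and `P w = 0`: for `n ≥ 0` the function `P (tⁿ w)` is `T(c) (tⁿ f)`, and for `n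
  -- ≤ 0` it vanishes. Since the products of `w` with trigonometric polynomials are dense in `L^p`,
  -- their projections are dense in `H^p`.
  have hmem (x : ℤ →₀ ℂ) : rieszP p (mulC p (trigPoly x) w) ∈ (toeplitz p c).range := by
    induction x using Finsupp.induction_linear with
    | zero => simp
    | add x y hx hy =>
      rw [map_add, map_add, add_apply, map_add]
      exact Submodule.add_mem _ hx hy
    | single n z =>
      rw [trigPoly_single, map_smul, smul_apply, map_smul]
      refine Submodule.smul_mem _ _ ?_
      rcases le_total 0 n with hn | hn
      · refine ⟨⟨mulC p (fourier n) f, fun m hm => ?_⟩, ?_⟩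
        · rw [fourierCoeff_mulC_fourier]
          exact f.2 _ (by omega)
        · change rieszP p (mulOp p c (mulC p (fourier n) f)) = _
          congr 1
          apply Lp.ext
          filter_upwards [coeFn_mulOp p c (mulC p (fourier n) f), coeFn_mulC p (fourier n) f,
            coeFn_mulC p (fourier n) w, coeFn_mulOp p c f] with t h2 h3 h4 h5
          rw [h2, h3, h4, hw, h5]
          ring
      · have : rieszP p (mulC p (fourier n) w) = 0 := by
          refine Subtype.ext (eq_zero_of_fourierCoeff p _ fun m => ?_)
          rw [fourierCoeff_rieszP p h1 hp, fourierCoeff_mulC_fourier]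
          split_ifs with hm
          · exact hcoeff _ (by omega)
          · rfl
        rw [this]
        exact Submodule.zero_mem _
  have hsurj : Function.Surjective (rieszP p) := fun g => ⟨g, rieszP_coe p h1 hp g⟩
  have hd := hsurj.denseRange.comp (denseRange_mulC_trigPoly p hp w hw0) (rieszP p).continuous
  refine hd.mono ?_
  rintro _ ⟨x, rfl⟩
  obtain ⟨g, hg⟩ := hmem x
  exact ⟨g, hg⟩

section Fredholm

variable {X : Type*} [NormedAddCommGroup X] [NormedSpace ℂ X]

lemma mem_ker_adjointOp {T : X →L[ℂ] X} {φ : StrongDual ℂ X} :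
    φ ∈ (adjointOp T).ker ↔ ∀ x, φ (T x) = 0 := by
  rw [LinearMap.mem_ker]
  exact ContinuousLinearMap.ext_iff

lemma ker_adjointOp_eq_bot_of_denseRange {T : X →L[ℂ] X} (h : DenseRange T) :
    (adjointOp T).ker = ⊥ := by
  refine (Submodule.eq_bot_iff _).2 fun φ hφ => ?_
  rw [mem_ker_adjointOp] at hφ
  ext x
  exact h.induction_on (p := fun x => φ x = 0) x (isClosed_eq φ.continuous continuous_const) hφ

/-- Functionals vanishing on the range factor through the finite-dimensional cokernel. This is
needed because `finrank` is also `0` on infinite-dimensional spaces. -/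
lemma finiteDimensional_ker_adjointOp {T : X →L[ℂ] X} (hT : T.IsFredholm) :
    FiniteDimensional ℂ (adjointOp T).ker := by
  have : FiniteDimensional ℂ (X ⧸ T.range) := hT.finite_coker
  let L : (adjointOp T).ker →ₗ[ℂ] Module.Dual ℂ (X ⧸ T.range) :=
    { toFun := fun φ => T.range.liftQ φ.1.toLinearMap (by
        rintro _ ⟨x, rfl⟩
        exact mem_ker_adjointOp.1 φ.2 x)
      map_add' := fun φ ψ => by ext; rfl
      map_smul' := fun z φ => by ext; rfl }
  refine FiniteDimensional.of_injective L fun φ ψ h => ?_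
  ext x
  exact LinearMap.congr_fun h (T.range.mkQ x)

/-- A proper closed range would be annihilated by a nonzero functional, pulled back from the
quotient. -/
lemma surjective_of_ker_adjointOp_eq_bot {T : X →L[ℂ] X} (hT : IsClosed (T.range : Set X))
    (h : (adjointOp T).ker = ⊥) : Function.Surjective T := by
  rw [← ContinuousLinearMap.coe_coe, ← LinearMap.range_eq_top]
  by_contra hne
  obtain ⟨x, -, hx⟩ := SetLike.exists_of_lt (lt_top_iff_ne_top.2 hne)
  have : IsClosed (T.range : Set X) := hT
  obtain ⟨φ, hφ⟩ := SeparatingDual.exists_ne_zero (R := ℂ)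
    (x := T.range.mkQ x) (by simpa using hx)
  have hmem : φ ∘L T.range.mkQL ∈ (adjointOp T).ker := mem_ker_adjointOp.2 fun y => by
    change φ (T.range.mkQ (T y)) = 0
    have hy : T.range.mkQ (T y) = 0 := (Submodule.Quotient.mk_eq_zero T.range).2 ⟨y, rfl⟩
    rw [hy, map_zero]
  rw [h, Submodule.mem_bot] at hmem
  exact hφ (DFunLike.congr_fun hmem x)

variable [CompleteSpace X]

/-- With `r` a bounded projection onto the kernel, `x ↦ (T x, r x)` is an isomorphism; its inverse
restricted to the first factor is the right inverse. -/
lemma hasRightInverse_of_surjective {T : X →L[ℂ] X} (h : Function.Surjective T)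
    (hk : T.ker.ClosedComplemented) : T.HasRightInverse := by
  obtain ⟨r, hr⟩ := hk
  have : CompleteSpace T.ker := T.isClosed_ker.completeSpace_coe
  let e := T.equivProdOfSurjectiveOfIsCompl r (LinearMap.range_eq_top.2 h)
    (LinearMap.range_eq_top.2 fun y => ⟨y, hr y⟩) (LinearMap.isCompl_of_proj hr)
  refine ⟨e.symm.toContinuousLinearMap ∘L .inl ℂ X T.ker, fun x => ?_⟩
  exact congrArg Prod.fst (e.apply_symm_apply (x, 0))

/-- Under the alternative of Coburn's lemma, a Fredholm operator of nonnegative index is right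
invertible. -/
lemma hasRightInverse_of_index_nonneg {T : X →L[ℂ] X} (hT : T.IsFredholm)
    (hcob : ∀ x, x ≠ 0 → T x = 0 → DenseRange T) (hi : 0 ≤ index T) : T.HasRightInverse := by
  have hbot : (adjointOp T).ker = ⊥ := by
    by_cases hker : T.ker = ⊥
    · have := finiteDimensional_ker_adjointOp hT
      rw [index, hker, finrank_bot] at hi
      exact Submodule.finrank_eq_zero.1 (by omega)
    · obtain ⟨x, hx, hx0⟩ := Submodule.exists_mem_ne_zero_of_ne_bot hker
      exact ker_adjointOp_eq_bot_of_denseRange (hcob x hx0 hx)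
  exact hasRightInverse_of_surjective (surjective_of_ker_adjointOp_eq_bot hT.isClosed_range hbot)
    hT.closedComplemented_ker

/-- Under the alternative of Coburn's lemma, a Fredholm operator of nonpositive index is left
invertible. -/
lemma hasLeftInverse_of_index_nonpos {T : X →L[ℂ] X} (hT : T.IsFredholm)
    (hcob : ∀ x, x ≠ 0 → T x = 0 → DenseRange T) (hi : index T ≤ 0) : T.HasLeftInverse := by
  have hker : T.ker = ⊥ := by
    by_contra hker
    obtain ⟨x, hx, hx0⟩ := Submodule.exists_mem_ne_zero_of_ne_bot hker
    have := hT.finite_ker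
    rw [index, ker_adjointOp_eq_bot_of_denseRange (hcob x hx0 hx), finrank_bot] at hi
    exact hker (Submodule.finrank_eq_zero.1 (by omega))
  exact .of_injective_of_isClosed_range_of_closedComplement_range (LinearMap.ker_eq_bot.1 hker)
    hT.isClosed_range hT.closedComplemented_range

end Fredholm

end Coburn

/-! ### The operators of a matching pair -/

section Matching

lemma mul_linv {a : LInf} (ha : IsInvertible a) : ∀ᵐ t ∂arc, a t * linv a t = 1 := by
  rw [linv, dif_pos ha]
  exact ha.choose_spec

lemma IsInvertible.tilde {a : LInf} (ha : IsInvertible a) : IsInvertible (tilde a) := by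
  obtain ⟨a', ha'⟩ := ha
  refine ⟨ToeplitzHankel.tilde a', ?_⟩
  filter_upwards [coeFn_tilde a, coeFn_tilde a', ae_neg ha'] with t h1 h2 h3
  rw [h1, h2, h3]

namespace IsMatchingPair

variable {a b : LInf}

lemma ae_matching (hab : IsMatchingPair a b) :
    ∀ᵐ t ∂arc, a t * tilde a t = b t * tilde b t := by
  filter_upwards [coeFn_lmul a (tilde a), coeFn_lmul b (tilde b)] with t h1 h2
  rw [← h1, ← h2, hab.matching]

lemma isInvertible_right (hab : IsMatchingPair a b) : IsInvertible b := by
  obtain ⟨a', ha'⟩ := hab.invertible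
  obtain ⟨e, he⟩ := hab.invertible.tilde
  refine ⟨lmul (tilde b) (lmul a' e), ?_⟩
  filter_upwards [coeFn_lmul (tilde b) (lmul a' e), coeFn_lmul a' e, ha', he, hab.ae_matching]
    with t h1 h2 h3 h4 h5
  rw [h1, h2]
  linear_combination (-(a' t * e t)) * h5 + (tilde a t * e t) * h3 + h4

lemma matchC_ne_zero (hab : IsMatchingPair a b) : ∀ᵐ t ∂arc, matchC a b t ≠ 0 := by
  filter_upwards [coeFn_lmul a (linv b), mul_linv hab.invertible,
    mul_linv hab.isInvertible_right] with t h1 h2 h3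
  rw [matchC, h1]
  exact mul_ne_zero (left_ne_zero_of_mul_eq_one h2) (right_ne_zero_of_mul_eq_one h3)

lemma matchD_ne_zero (hab : IsMatchingPair a b) : ∀ᵐ t ∂arc, matchD a b t ≠ 0 := by
  filter_upwards [coeFn_lmul b (linv (tilde a)), mul_linv hab.invertible.tilde,
    mul_linv hab.isInvertible_right] with t h1 h2 h3
  rw [matchD, h1]
  exact mul_ne_zero (left_ne_zero_of_mul_eq_one h3) (right_ne_zero_of_mul_eq_one h2)

end IsMatchingPair

variable (p : ℝ≥0∞) [Fact (1 ≤ p)]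

lemma mulOp_mulOp {u v w : LInf} (h : ∀ᵐ t ∂arc, u t * v t = w t) (f : LpT p) :
    mulOp p u (mulOp p v f) = mulOp p w f := by
  apply Lp.ext
  filter_upwards [coeFn_mulOp p u (mulOp p v f), coeFn_mulOp p v f, coeFn_mulOp p w f, h]
    with t h1 h2 h3 h4
  rw [h1, h2, h3, ← h4, mul_assoc]

lemma mulOp_mulOp_of_mul_eq_one {u v : LInf} (h : ∀ᵐ t ∂arc, u t * v t = 1) (f : LpT p) :
    mulOp p u (mulOp p v f) = f := by
  apply Lp.ext
  filter_upwards [coeFn_mulOp p u (mulOp p v f), coeFn_mulOp p v f, h] with t h1 h2 h3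
  rw [h1, h2, ← mul_assoc, h3, one_mul]

lemma rieszP_flipJ (h1 : 1 < p) (hp : p ≠ ∞) (f : Hardy p) : rieszP p (flipJ p f) = 0 := by
  refine Subtype.ext (eq_zero_of_fourierCoeff p _ fun n => ?_)
  rw [fourierCoeff_rieszP p h1 hp, fourierCoeff_flipJ]
  split_ifs with hn
  · exact f.2 _ (by omega)
  · rfl

lemma coe_rieszP_flipJ (h1 : 1 < p) (hp : p ≠ ∞) (f : LpT p) (hf : rieszP p f = 0) :
    (rieszP p (flipJ p f) : LpT p) = flipJ p f := by
  have hmem : flipJ p f ∈ Hardy p := fun n hn => by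
    have h := fourierCoeff_rieszP p h1 hp f (-1 - n)
    rw [if_pos (by omega), hf] at h
    rw [fourierCoeff_flipJ, ← h]
    exact (coeffL p _).map_zero
  exact congrArg Subtype.val (rieszP_coe p h1 hp ⟨flipJ p f, hmem⟩)

lemma IsMatchingPair.matchingOperators (h1 : 1 < p) (hp : p ≠ ∞) {a b : LInf}
    (hab : IsMatchingPair a b) :
    MatchingOperators (rieszP p) (Hardy p).subtypeL (flipJ p) (mulOp p a) (mulOp p (tilde a))
      (mulOp p b) (mulOp p (tilde b)) (mulOp p (matchC a b)) (mulOp p (matchD a b))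
      (mulOp p (linv (tilde a))) := by
  have hw := mul_linv hab.invertible.tilde
  have hb := mul_linv hab.isInvertible_right
  have hm := hab.ae_matching
  have hc := coeFn_lmul a (linv b)
  have hd := coeFn_lmul b (linv (tilde a))
  refine ⟨rieszP_coe p h1 hp, rieszP_flipJ p h1 hp, coe_rieszP_flipJ p h1 hp, flipJ_flipJ p,
    mulOp_flipJ p _ _ ?_, mulOp_flipJ p _ _ ?_, mulOp_mulOp p ?_, mulOp_mulOp p ?_,
    mulOp_mulOp p ?_, mulOp_mulOp_of_mul_eq_one p ?_, mulOp_mulOp_of_mul_eq_one p hw,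
    mulOp_mulOp p ?_⟩
  · filter_upwards [ae_neg (coeFn_tilde a)] with t h
    rw [h, neg_neg]
  · filter_upwards [ae_neg (coeFn_tilde b)] with t h
    rw [h, neg_neg]
  · filter_upwards [hw, hm, hd] with t hw hm hd
    rw [matchD, hd]
    linear_combination (-linv (tilde a) t) * hm + a t * hw
  · filter_upwards [hw, hd] with t hw hd
    rw [matchD, hd]
    linear_combination b t * hw
  · filter_upwards [hw, hb, hm, hc] with t hw hb hm hc
    rw [matchC, hc]
    linear_combination (-(linv (tilde a) t * tilde b t)) * hb -
      linv (tilde a) t * linv b t * hm + a t * linv b t * hw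
  · filter_upwards [hw] with t hw
    rw [mul_comm, hw]
  · filter_upwards [hb, hm, hc] with t hb hm hc
    rw [matchC, hc]
    linear_combination linv b t * hm + tilde b t * hb

/-- On the image of `H^p` under `J` the projection `Q` acts as the identity. -/
lemma hankel_eq (h1 : 1 < p) (hp : p ≠ ∞) (b : LInf) :
    hankel p b = rieszP p ∘L (mulOp p b ∘L flipJ p) ∘L (Hardy p).subtypeL := by
  ext1 f
  have h : rieszQ p (flipJ p f) = flipJ p f := by
    change flipJ p f - (rieszP p (flipJ p f) : LpT p) = flipJ p f
    rw [rieszP_flipJ p h1 hp, Submodule.coe_zero, sub_zero]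
  change rieszP p (mulOp p b (rieszQ p (flipJ p f))) = _
  rw [h]
  rfl

lemma toeplitz_add_hankel (h1 : 1 < p) (hp : p ≠ ∞) (a b : LInf) :
    toeplitz p a + hankel p b =
      rieszP p ∘L (mulOp p a + mulOp p b ∘L flipJ p) ∘L (Hardy p).subtypeL := by
  rw [hankel_eq p h1 hp, toeplitz, ContinuousLinearMap.add_comp, ContinuousLinearMap.comp_add]

lemma toeplitz_sub_hankel (h1 : 1 < p) (hp : p ≠ ∞) (a b : LInf) :
    toeplitz p a - hankel p b =
      rieszP p ∘L (mulOp p a + (-mulOp p b) ∘L flipJ p) ∘L (Hardy p).subtypeL := by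
  rw [hankel_eq p h1 hp, toeplitz, ContinuousLinearMap.add_comp, ContinuousLinearMap.comp_add,
    ContinuousLinearMap.neg_comp, ContinuousLinearMap.neg_comp, ContinuousLinearMap.comp_neg,
    sub_eq_add_neg]

lemma comp_neg_mulOp_comp (c : LInf) :
    rieszP p ∘L (-mulOp p c) ∘L (Hardy p).subtypeL = -toeplitz p c := by
  rw [ContinuousLinearMap.neg_comp, ContinuousLinearMap.comp_neg, toeplitz]

lemma hasRightInverse_neg {X : Type*} [NormedAddCommGroup X] [NormedSpace ℂ X] {T : X →L[ℂ] X}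
    (h : T.HasRightInverse) : (-T).HasRightInverse := by
  obtain ⟨S, hS⟩ := h
  refine ⟨-S, fun x => ?_⟩
  rw [neg_apply, neg_apply, map_neg, neg_neg]
  exact hS x

lemma hasLeftInverse_neg {X : Type*} [NormedAddCommGroup X] [NormedSpace ℂ X] {T : X →L[ℂ] X}
    (h : T.HasLeftInverse) : (-T).HasLeftInverse := by
  obtain ⟨S, hS⟩ := h
  refine ⟨-S, fun x => ?_⟩
  rw [neg_apply, neg_apply, map_neg, neg_neg]
  exact hS x

end Matching

end ToeplitzHankel

end

open ToeplitzHankel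
theorem mainTheorem6 (p : ℝ≥0∞) [Fact (1 ≤ p)] (hp₁ : 1 < p) (hp₂ : p < ∞)
    (a b : LInf) (hab : IsMatchingPair a b)
    (hc : (toeplitz p (matchC a b)).IsFredholm)
    (hd : (toeplitz p (matchD a b)).IsFredholm) :
    (0 ≤ index (toeplitz p (matchC a b)) →
      0 ≤ index (toeplitz p (matchD a b)) →
        (toeplitz p a + hankel p b).HasRightInverse ∧
        (toeplitz p a - hankel p b).HasRightInverse) ∧
    (index (toeplitz p (matchC a b)) ≤ 0 →
      index (toeplitz p (matchD a b)) ≤ 0 →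
        (toeplitz p a + hankel p b).HasLeftInverse ∧
        (toeplitz p a - hankel p b).HasLeftInverse) := by
  have hM := hab.matchingOperators p hp₁ hp₂.ne
  have hcobC := denseRange_toeplitz p hp₁ hp₂.ne _ hab.matchC_ne_zero
  have hcobD := denseRange_toeplitz p hp₁ hp₂.ne _ hab.matchD_ne_zero
  rw [toeplitz_add_hankel p hp₁ hp₂.ne, toeplitz_sub_hankel p hp₁ hp₂.ne]
  refine ⟨fun hic hid => ?_, fun hic hid => ?_⟩
  · have hC := hasRightInverse_of_index_nonneg hc hcobC hic
    have hD := hasRightInverse_of_index_nonneg hd hcobD hid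
    -- For the minus sign the matching functions are `-c` and `-d`, whose Toeplitz operators inherit
    -- the one-sided inverses up to sign.
    refine ⟨hM.hasRightInverse hC hD, hM.neg.hasRightInverse ?_ ?_⟩ <;> rw [comp_neg_mulOp_comp]
    exacts [hasRightInverse_neg hC, hasRightInverse_neg hD]
  · have hC := hasLeftInverse_of_index_nonpos hc hcobC hic
    have hD := hasLeftInverse_of_index_nonpos hd hcobD hid
    refine ⟨hM.hasLeftInverse hC hD, hM.neg.hasLeftInverse ?_ ?_⟩ <;> rw [comp_neg_mulOp_comp]
    exacts [hasLeftInverse_neg hC, hasLeftInverse_neg hD]
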